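/- Let $f=(f_1,f_2,f_3):\mathbb R^3\to\mathbb R^3$ be a polynomial map and $J=\det Df$. For a smooth map $F:\mathbb R^3\to\mathbb R^3$ put $S_1(F)=\{p:\operatorname{rank}DF(p)=2\}$, $S_{1,1}(F)=\{p\in S_1(F):\operatorname{rank}D(F|S_1(F))(p)=1\}$ and $S_{1,1,1}(F)=\{p\in S_{1,1}(F):\operatorname{rank}D(F|S_{1,1}(F))(p)=0\}$, where the rank of $D(F|S)(p)$ is the dimension of $DF(p)(T_pS)$; the last two definitions presuppose that $S_1(F)$ is a smooth surface and that $S_{1,1}(F)$ is a smooth curve. A point $p$ is a simple swallowtail point of $f$ if $\operatorname{rank}Df(p)=2$ and there is a smooth vector field $K$ near $p$ with $K(p)\ne0$ and $Df(q)K(q)=0$ for all $q\in S_1(f)$ near $p$ such that, with $X=\langle\nabla J,K\rangle$ and $Y=\langle\nabla X,K\rangle$, one has $J(p)=X(p)=Y(p)=0$ and $\nabla J(p),\nabla X(p),\nabla Y(p)$ are linearly independent. Its sign is then $I(f,p)=\operatorname{sgn}\bigl(Z(p)\cdot\det[D(J,X,Y)(p)]\bigr)\in\{1,-1\}$, where $Z=\langle\nabla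 Y,K\rangle$; it does not depend on the choice of $K$. For $1\le i<j\le3$ let $K_{ij}=\nabla f_i\times\nabla f_j$, $X_{ij}=\langle\nabla J,K_{ij}\rangle$, $Y_{ij}=\langle\nabla X_{ij},K_{ij}\rangle$, $Z_{ij}=\langle\nabla Y_{ij},K_{ij}\rangle$ and $g_{ij}=Z_{ij}\cdot\det D(J,X_{ij},Y_{ij})$. In $\mathbb R[x,y,z]$ let $I_1$ be the ideal generated by $J$, $\partial J/\partial x$, $\partial J/\partial y$, $\partial J/\partial z$; let $I_2$ be generated by $J$ and all $2\times2$ minors of $Df$; let $I_3$ be generated by $J,X_{12},X_{13},X_{23}$ and all $2\times2$ minors of $D(J,X_{12},X_{13},X_{23})$; and let $I$ be generated by $J$, all $X_{ij}$ and all $Y_{ij}$. Put $\mathcal A=\mathbb R[x,y,z]/I$ and let $V(I)\subset\mathbb R^3$ be the set of real zeros of $I$. If $\dim_{\mathbb R}\mathcal A<\infty$, let $t(u)$ be the trace of multiplication by $u$ on $\mathcal A$, and for $g=\sum_{i<j}\alpha_{ij}g_{ij}$, with real $\alpha_{ij}\ge0$ that are not all zero, define quadratic forms on $\mathcal A$ by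 $\Theta(h)=t(h^2)$ and $\Psi(h)=t(g h^2)$. Let $\sigma$ denote the signature of a quadratic form. **Theorem.** Assume that $I_1=I_2=I_3=\mathbb R[x,y,z]$ and $\dim_{\mathbb R}\mathcal A<\infty$. Then $S_1(f)$ is empty or a smooth surface, $S_{1,1}(f)$ is empty or a smooth curve, $S_{1,1,1}(f)=V(I)$ is finite, and $$\sigma(\Theta)=\#S_{1,1,1}(f).$$ If, for a choice of the $\alpha_{ij}$ as above, $\Psi$ is non-degenerate, then all points of $S_{1,1,1}(f)$ are simple swallowtail points, $$\sigma(\Psi)=\sum_{p\in S_{1,1,1}(f)}I(f,p),$$ and $$\#\{p\in S_{1,1,1}(f): I(f,p)=+1\}=\frac{\sigma(\Theta)+\sigma(\Psi)}2,\qquad \#\{p\in S_{1,1,1}(f): I(f,p)=-1\}=\frac{\sigma(\Theta)-\sigma(\Psi)}2.$$ -/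

import Mathlib

open MvPolynomial Topology
open scoped ContDiff Gradient

noncomputable section

namespace Swallowtail

/-- Euclidean three-space. -/
abbrev E3 := EuclideanSpace ℝ (Fin 3)

/-- The polynomial ring `ℝ[x, y, z]`. -/
abbrev R3 := MvPolynomial (Fin 3) ℝ

/-! ### Submanifolds, tangent spaces, and the singular strata of a map -/

/-- `S` is a (possibly empty) smooth embedded submanifold of `ℝ³` of codimension `c`:
near each of its points it is the zero set of a smooth submersion to `ℝᶜ`. -/
def IsSmoothSubmanifold (c : ℕ) (S : Set E3) : Prop :=
  ∀ p ∈ S, ∃ (U : Set E3) (F : E3 → EuclideanSpace ℝ (Fin c)),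
    IsOpen U ∧ p ∈ U ∧ ContDiffOn ℝ ∞ F U ∧
      Function.Surjective (fderiv ℝ F p) ∧ S ∩ U = {q ∈ U | F q = 0}

/-- The tangent space at `p` of `S ⊆ ℝ³`: spanned by the velocities at `p` of the smooth
curves in `S` through `p`. (If `S` is a submanifold, these velocities already form a subspace.) -/
def tangentTo (S : Set E3) (p : E3) : Submodule ℝ E3 :=
  Submodule.span ℝ {v | ∃ γ : ℝ → E3, γ 0 = p ∧
    (∀ᶠ t in 𝓝 (0 : ℝ), ContDiffAt ℝ ∞ γ t ∧ γ t ∈ S) ∧ deriv γ 0 = v}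

/-- The rank at `p` of the differential of the restriction `f|S`. -/
def rankRestrict (f : E3 → E3) (S : Set E3) (p : E3) : ℕ :=
  Module.finrank ℝ ((tangentTo S p).map (fderiv ℝ f p : E3 →ₗ[ℝ] E3))

/-- The points where `f` has corank one. -/
def S1 (f : E3 → E3) : Set E3 :=
  {p | Module.finrank ℝ (LinearMap.range (fderiv ℝ f p : E3 →ₗ[ℝ] E3)) = 2}

/-- The points of the surface `S1 f` where `f|S1 f` has corank one. -/
def S11 (f : E3 → E3) : Set E3 :=
  {p | p ∈ S1 f ∧ rankRestrict f (S1 f) p = 1}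

/-- The points of the curve `S11 f` where `f|S11 f` has corank one. -/
def S111 (f : E3 → E3) : Set E3 :=
  {p | p ∈ S11 f ∧ rankRestrict f (S11 f) p = 0}

/-! ### Simple swallowtails and their signs -/

/-- The Jacobian determinant of `f`. -/
def jacobian (f : E3 → E3) (p : E3) : ℝ := (fderiv ℝ f p).det

/-- `⟨∇u, K⟩`, for a function `u` and a vector field `K`. -/
def along (K : E3 → E3) (u : E3 → ℝ) (p : E3) : ℝ := inner ℝ (∇ u p) (K p)

/-- `X = ⟨∇J, K⟩`. -/
def fieldX (f K : E3 → E3) : E3 → ℝ := along K (jacobian f)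

/-- `Y = ⟨∇X, K⟩`. -/
def fieldY (f K : E3 → E3) : E3 → ℝ := along K (fieldX f K)

/-- `Z = ⟨∇Y, K⟩`. -/
def fieldZ (f K : E3 → E3) : E3 → ℝ := along K (fieldY f K)

/-- `H = (J, X, Y)`. -/
def fieldH (f K : E3 → E3) (p : E3) : E3 := !₂[jacobian f p, fieldX f K p, fieldY f K p]

/-- `K` is a smooth vector field near `p`, not vanishing at `p`, that lies in the kernel of `Df`
along `S1 f`. -/
def IsKernelField (f : E3 → E3) (p : E3) (K : E3 → E3) : Prop :=
  K p ≠ 0 ∧ ∀ᶠ q in 𝓝 p, ContDiffAt ℝ ∞ K q ∧ (q ∈ S1 f → fderiv ℝ f q (K q) = 0)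

/-- `p` is a simple swallowtail point of `f`. -/
def IsSimpleSwallowtail (f : E3 → E3) (p : E3) : Prop :=
  p ∈ S1 f ∧ ∃ K : E3 → E3, IsKernelField f p K ∧
    jacobian f p = 0 ∧ fieldX f K p = 0 ∧ fieldY f K p = 0 ∧
    LinearIndependent ℝ ![∇ (jacobian f) p, ∇ (fieldX f K) p, ∇ (fieldY f K) p]

open Classical in
/-- The sign `I(f, p) = sgn (Z(p) · det DH(p))` of a simple swallowtail point `p`, computed with
any kernel field `K` as in the definition of a simple swallowtail.
(It is `0` by convention if `p` is not a simple swallowtail point.) -/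
def swallowtailSign (f : E3 → E3) (p : E3) : ℤ :=
  if h : IsSimpleSwallowtail f p then
    (SignType.sign (fieldZ f h.2.choose p * (fderiv ℝ (fieldH f h.2.choose) p).det) : ℤ)
  else 0

/-! ### The polynomial data -/

/-- The map `ℝ³ → ℝ³` given by three polynomials. -/
def polyMap (f : Fin 3 → R3) (p : E3) : E3 := WithLp.toLp 2 fun i => eval (fun j => p j) (f i)

/-- The real zeros of an ideal of `ℝ[x, y, z]`. -/
def realZeros (I : Ideal R3) : Set E3 := {p | ∀ u ∈ I, eval (fun j => p j) u = 0}

/-- The gradient of a polynomial. -/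
def grad (u : R3) : Fin 3 → R3 := fun i => pderiv i u

/-- The derivative matrix of a tuple of polynomials; its rows are the gradients. -/
def derivMatrix {m : ℕ} (u : Fin m → R3) : Matrix (Fin m) (Fin 3) R3 :=
  Matrix.of fun i => grad (u i)

/-- The set of all `2 × 2` minors of a matrix. -/
def minors2 {m n : ℕ} (A : Matrix (Fin m) (Fin n) R3) : Set R3 :=
  {d | ∃ (r : Fin 2 ↪o Fin m) (c : Fin 2 ↪o Fin n), d = (A.submatrix r c).det}

/-- `J = det Df`. -/
def polyJ (f : Fin 3 → R3) : R3 := (derivMatrix f).det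

/-- `K_{ij} = ∇f_i × ∇f_j`. -/
def polyK (f : Fin 3 → R3) (i j : Fin 3) : Fin 3 → R3 := crossProduct (grad (f i)) (grad (f j))

/-- `X_{ij} = ⟨∇J, K_{ij}⟩`. -/
def polyX (f : Fin 3 → R3) (i j : Fin 3) : R3 := grad (polyJ f) ⬝ᵥ polyK f i j

/-- `Y_{ij} = ⟨∇X_{ij}, K_{ij}⟩`. -/
def polyY (f : Fin 3 → R3) (i j : Fin 3) : R3 := grad (polyX f i j) ⬝ᵥ polyK f i j

/-- `Z_{ij} = ⟨∇Y_{ij}, K_{ij}⟩`. -/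
def polyZ (f : Fin 3 → R3) (i j : Fin 3) : R3 := grad (polyY f i j) ⬝ᵥ polyK f i j

/-- `g_{ij} = Z_{ij} · det D(J, X_{ij}, Y_{ij})`. -/
def polyG (f : Fin 3 → R3) (i j : Fin 3) : R3 :=
  polyZ f i j * (derivMatrix ![polyJ f, polyX f i j, polyY f i j]).det

/-- `g = ∑_{i < j} α_{ij} g_{ij}`. -/
def weightedG (f : Fin 3 → R3) (α : Fin 3 → Fin 3 → ℝ) : R3 :=
  ∑ i, ∑ j ∈ Finset.Ioi i, C (α i j) * polyG f i j

/-- The ideal generated by `J` and its partial derivatives. -/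
def ideal1 (f : Fin 3 → R3) : Ideal R3 :=
  Ideal.span ({polyJ f} ∪ Set.range (grad (polyJ f)))

/-- The ideal generated by `J` and the `2 × 2` minors of `Df`. -/
def ideal2 (f : Fin 3 → R3) : Ideal R3 :=
  Ideal.span ({polyJ f} ∪ minors2 (derivMatrix f))

/-- The ideal generated by `J, X₁₂, X₁₃, X₂₃` and the `2 × 2` minors of
`D(J, X₁₂, X₁₃, X₂₃)`. -/
def ideal3 (f : Fin 3 → R3) : Ideal R3 :=
  Ideal.span ({polyJ f, polyX f 0 1, polyX f 0 2, polyX f 1 2} ∪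
    minors2 (derivMatrix ![polyJ f, polyX f 0 1, polyX f 0 2, polyX f 1 2]))

/-- The ideal `I` generated by `J`, all `X_{ij}` and all `Y_{ij}`, `i < j`. -/
def idealI (f : Fin 3 → R3) : Ideal R3 :=
  Ideal.span {u | u = polyJ f ∨ ∃ i j : Fin 3, i < j ∧ (u = polyX f i j ∨ u = polyY f i j)}

/-- The algebra `𝒜 = ℝ[x, y, z] / I`. -/
abbrev AlgA (f : Fin 3 → R3) : Type := R3 ⧸ idealI f

/-! ### Trace forms and signatures -/

/-- The quadratic form `h ↦ t(a h²)` on an `ℝ`-algebra `A`, where `t(b)` is the trace of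
multiplication by `b`. -/
def traceQuad {A : Type*} [CommRing A] [Algebra ℝ A] (a : A) : QuadraticForm ℝ A :=
  LinearMap.BilinMap.toQuadraticMap ((Algebra.traceForm ℝ A).compLeft (LinearMap.mulLeft ℝ a))

theorem traceQuad_apply {A : Type*} [CommRing A] [Algebra ℝ A] (a h : A) :
    traceQuad a h = Algebra.trace ℝ A (a * h ^ 2) := by
  simp [traceQuad, Algebra.traceForm_apply, pow_two, mul_assoc]

/-- `Θ(h) = t(h²)`. -/
def formTheta (f : Fin 3 → R3) : QuadraticForm ℝ (AlgA f) := traceQuad 1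

/-- `Ψ(h) = t(g h²)`. -/
def formPsi (f : Fin 3 → R3) (α : Fin 3 → Fin 3 → ℝ) : QuadraticForm ℝ (AlgA f) :=
  traceQuad (Ideal.Quotient.mk (idealI f) (weightedG f α))

/-- The signature of a real quadratic form. -/
def signature {V : Type*} [AddCommGroup V] [Module ℝ V] (Q : QuadraticForm ℝ V) : ℤ :=
  (sigPos Q : ℤ) - (sigNeg Q : ℤ)

end Swallowtail

end

open Swallowtail

noncomputable section

namespace Swallowtail

/-! ### Signatures of quadratic forms -/

section Signature

variable {V W : Type*} [AddCommGroup V] [Module ℝ V] [AddCommGroup W] [Module ℝ W]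

/-! The algebraic half: for a finite real algebra `A`, the map onto the product of its residue
fields has nilpotent kernel, and nilpotents have trace zero. So `h ↦ t(a h²)` is the pullback of an
orthogonal sum of forms on the residue fields. A field `ℂ` contributes 0, because multiplication by
`i` negates the form; a field `ℝ`, that is a real character `φ`, contributes the sign of `φ a`,
because primitive idempotents have positive trace (`signature_traceQuad`). The real characters of
`𝒜` are the points of `V(I)`, so `Θ` counts these points and `Ψ` counts them with the sign of `g`.

The geometric half: `I₂ = (1)` makes some `K_{ij}` span the kernel of `Df` at each zero of `J`.
Tangency of this `K_{ij}` to the surface, then to the curve, is `X_{ij} = 0`, then `Y_{ij} = 0`,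
while `I₁ = I₃ = (1)` provide the independent gradients. The link is `along_comparison`: if `K' =
cK` on `J = 0`, then at a point where `X = Y = 0` one has `Z' = c³Z`, and the gradients of `J, X',
Y'` arise from those of `J, X, Y` by a triangular matrix with diagonal `1, c, c²`. Hence `Z · det`
is multiplied by `c⁶ ≥ 0`. This makes the sign independent of `K`, and makes `g` a nonnegative
multiple of the single `g_{ij}` with `K_{ij} ≠ 0`. -/

theorem signature_congr {Q : QuadraticForm ℝ V} {Q' : QuadraticForm ℝ W} (h : Q.Equivalent Q') :
    signature Q = signature Q' := by
  rw [signature, signature, h.sigPos_eq, h.sigNeg_eq]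

theorem signature_neg (Q : QuadraticForm ℝ V) : signature (-Q) = -signature Q := by
  simp [signature]

/-- The positive index of inertia does not change under pullback along a surjection. -/
theorem sigPos_comp_of_surjective [Module.Finite ℝ V] (Q : QuadraticForm ℝ W) (φ : V →ₗ[ℝ] W)
    (hφ : Function.Surjective φ) : sigPos (Q.comp φ) = sigPos Q := by
  have : Module.Finite ℝ W := Module.Finite.of_surjective φ hφ
  apply le_antisymm
  · obtain ⟨U, hU, hpos⟩ := exists_finrank_eq_sigPos_and_posDef (Q.comp φ)
    -- `Q ∘ φ` vanishes on `ker φ`, so a positive definite subspace meets it trivially and keeps its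
    -- dimension under `φ`.
    have hinj : LinearMap.ker (φ.domRestrict U) = ⊥ := by
      rw [LinearMap.ker_eq_bot']
      intro u hu
      by_contra hne
      have := hpos u hne
      simp only [QuadraticMap.restrict_apply, QuadraticMap.comp_apply] at this
      rw [LinearMap.domRestrict_apply] at hu
      simp [hu] at this
    rw [← hU, ← LinearMap.finrank_range_of_inj (LinearMap.ker_eq_bot.mp hinj)]
    apply le_sigPos_of_posDef
    rintro ⟨w, u, rfl⟩ hw
    refine hpos u ?_
    rintro rfl
    exact hw (by ext; simp)
  · obtain ⟨U, hU, hpos⟩ := exists_finrank_eq_sigPos_and_posDef Q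
    obtain ⟨s, hs⟩ := φ.exists_rightInverse_of_surjective (LinearMap.range_eq_top.mpr hφ)
    have hs' : ∀ w, φ (s w) = w := fun w => LinearMap.congr_fun hs w
    have hinj : Function.Injective s := fun x y h => by rw [← hs' x, h, hs']
    rw [← hU, (Submodule.equivMapOfInjective s hinj U).finrank_eq]
    apply le_sigPos_of_posDef
    rintro ⟨w, u, hu, rfl⟩ hw
    simp only [QuadraticMap.restrict_apply, QuadraticMap.comp_apply, hs']
    refine hpos ⟨u, hu⟩ ?_
    intro h0
    apply hw
    have : u = 0 := congrArg Subtype.val h0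
    ext
    simp [this]

theorem signature_comp_of_surjective [Module.Finite ℝ V] (Q : QuadraticForm ℝ W) (φ : V →ₗ[ℝ] W)
    (hφ : Function.Surjective φ) : signature (Q.comp φ) = signature Q := by
  have h : -(Q.comp φ) = (-Q).comp φ := by ext; simp
  rw [signature, signature, sigPos_comp_of_surjective Q φ hφ, sigNeg, h,
    sigPos_comp_of_surjective (-Q) φ hφ, sigNeg]

theorem signature_weightedSumSquares {ι : Type*} [Fintype ι] (w : ι → ℝ) :
    signature (QuadraticMap.weightedSumSquares ℝ w) = ∑ i, (SignType.sign (w i) : ℤ) := by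
  classical
  rw [signature, QuadraticForm.sigPos_weightedSumSquares, QuadraticForm.sigNeg_weightedSumSquares,
    Set.ncard_eq_toFinset_card', Set.ncard_eq_toFinset_card', Finset.card_eq_sum_ones,
    Finset.card_eq_sum_ones, Set.toFinset_ofPred, Set.toFinset_ofPred, Finset.sum_filter,
    Finset.sum_filter]
  push_cast
  rw [← Finset.sum_sub_distrib]
  refine Finset.sum_congr rfl fun i _ => ?_
  rcases lt_trichotomy (w i) 0 with h | h | h
  · simp [h, h.not_gt]
  · simp [h]
  · simp [h, h.not_gt]

/-- The signature of an orthogonal sum is the sum of the signatures. -/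
theorem signature_pi {ι : Type*} [Fintype ι] {M : ι → Type*} [∀ i, AddCommGroup (M i)]
    [∀ i, Module ℝ (M i)] [∀ i, Module.Finite ℝ (M i)] (Q : ∀ i, QuadraticForm ℝ (M i)) :
    signature (QuadraticMap.pi Q) = ∑ i, signature (Q i) := by
  choose w hw using fun i => (Q i).equivalent_weightedSumSquares
  have h1 : (QuadraticMap.pi Q).Equivalent
      (QuadraticMap.pi fun i => QuadraticMap.weightedSumSquares ℝ (w i)) :=
    QuadraticMap.Equivalent.pi hw
  -- Diagonalized summands concatenate to one diagonal form, indexed by the disjoint union of the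
  -- index sets.
  have h2 : (QuadraticMap.weightedSumSquares ℝ
      (fun x : Σ i, Fin (Module.finrank ℝ (M i)) => w x.1 x.2)).Equivalent
      (QuadraticMap.pi fun i => QuadraticMap.weightedSumSquares ℝ (w i)) :=
    ⟨{ LinearEquiv.piCurry ℝ (fun _ _ => ℝ) with
        map_app' := fun v => by
          simp [QuadraticMap.weightedSumSquares_apply, Fintype.sum_sigma, Sigma.curry] }⟩
  rw [signature_congr h1, ← signature_congr h2, signature_weightedSumSquares, Fintype.sum_sigma]
  refine Finset.sum_congr rfl fun i _ => ?_
  rw [signature_congr (hw i), signature_weightedSumSquares]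

end Signature

/-! ### Trace forms of finite real algebras -/

/-- The quadratic form `x ↦ l (x²)` attached to a linear functional `l` on an algebra. -/
def functionalQuad {A : Type*} [CommRing A] [Algebra ℝ A] (l : A →ₗ[ℝ] ℝ) : QuadraticForm ℝ A :=
  LinearMap.BilinMap.toQuadraticMap ((LinearMap.mul ℝ A).compr₂ l)

theorem functionalQuad_apply {A : Type*} [CommRing A] [Algebra ℝ A] (l : A →ₗ[ℝ] ℝ) (x : A) :
    functionalQuad l x = l (x * x) := by
  simp [functionalQuad]

/-- A square root of `-1` forces the signature of `x ↦ l (x²)` to vanish. -/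
theorem signature_functionalQuad_of_sq_eq_neg_one {A : Type*} [CommRing A] [Algebra ℝ A]
    (l : A →ₗ[ℝ] ℝ) (j : A) (hj : j * j = -1) : signature (functionalQuad l) = 0 := by
  let e : A ≃ₗ[ℝ] A :=
    LinearEquiv.ofLinearMap (LinearMap.mulLeft ℝ j) (LinearMap.mulLeft ℝ (-j))
      (by ext x; simp [← mul_assoc, hj]) (by ext x; simp [← mul_assoc, hj])
  have he : ∀ x, e x = j * x := fun x => rfl
  -- Since `(jx)² = -x²`, multiplication by `j` is an isometry onto the negated form, so the
  -- signature equals its own negative.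
  have h : (functionalQuad l).Equivalent (-functionalQuad l) :=
    ⟨{ e with
        map_app' := fun x => by
          have : j * x * (j * x) = -(x * x) := by linear_combination (x * x) * hj
          simp [he, functionalQuad_apply, this] }⟩
  have := signature_congr h
  rw [signature_neg] at this
  omega

/-- Over `ℝ` itself the signature of `x ↦ l (x²)` is the sign of `l 1`. -/
theorem signature_functionalQuad_of_algEquiv {A : Type*} [CommRing A] [Algebra ℝ A]
    (l : A →ₗ[ℝ] ℝ) (e : A ≃ₐ[ℝ] ℝ) : signature (functionalQuad l) = SignType.sign (l 1) := by
  have h : (functionalQuad l).Equivalent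
      (QuadraticMap.weightedSumSquares ℝ (fun _ : Unit => l 1)) :=
    ⟨{ e.toLinearEquiv.trans (LinearEquiv.funUnique Unit ℝ ℝ).symm with
        map_app' := fun x => by
          have hx : x * x = (e x * e x) • (1 : A) := by
            apply e.injective
            simp
          simp [functionalQuad_apply, QuadraticMap.weightedSumSquares_apply, hx, mul_comm] }⟩
  rw [signature_congr h, signature_weightedSumSquares]
  simp

section TraceForm

variable (A : Type*) [CommRing A] [Algebra ℝ A]

/-- The map from an algebra to the product of its residue fields. -/
def toResidues : A →ₐ[ℝ] ∀ m : MaximalSpectrum A, A ⧸ m.asIdeal :=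
  AlgHom.pi fun m => Ideal.Quotient.mkₐ ℝ m.asIdeal

theorem toResidues_apply (a : A) (m : MaximalSpectrum A) :
    toResidues A a m = Ideal.Quotient.mk m.asIdeal a := rfl

theorem residue_ne_zero (A : Type*) [CommRing A] (m : MaximalSpectrum A) :
    (1 : A ⧸ m.asIdeal) ≠ 0 := by
  have : Nontrivial (A ⧸ m.asIdeal) := Ideal.Quotient.nontrivial_iff.mpr m.isMaximal.ne_top
  exact one_ne_zero

theorem algHom_ker_isMaximal (φ : A →ₐ[ℝ] ℝ) : (RingHom.ker φ).IsMaximal :=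
  RingHom.ker_isMaximal_of_surjective φ fun r => ⟨algebraMap ℝ A r, by simp⟩

/-- The maximal ideal of a real character. -/
def kerSpectrum (φ : A →ₐ[ℝ] ℝ) : MaximalSpectrum A :=
  ⟨RingHom.ker φ, algHom_ker_isMaximal A φ⟩

theorem kerSpectrum_injective : Function.Injective (kerSpectrum A) := by
  intro φ ψ h
  have h' : RingHom.ker φ = RingHom.ker ψ := congrArg MaximalSpectrum.asIdeal h
  ext a
  have : a - algebraMap ℝ A (φ a) ∈ RingHom.ker ψ := by
    rw [← h', RingHom.mem_ker]
    simp
  rw [RingHom.mem_ker, map_sub, AlgHom.commutes, sub_eq_zero] at this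
  exact this.symm

/-- The residue field of a real character. -/
def residueEquiv (φ : A →ₐ[ℝ] ℝ) : (A ⧸ (kerSpectrum A φ).asIdeal) ≃ₐ[ℝ] ℝ :=
  Ideal.quotientKerAlgEquivOfSurjective (f := φ) fun r => ⟨algebraMap ℝ A r, by simp⟩

theorem mk_kerSpectrum (φ : A →ₐ[ℝ] ℝ) (a : A) :
    Ideal.Quotient.mk (kerSpectrum A φ).asIdeal a = φ a • 1 := by
  apply (residueEquiv A φ).injective
  rw [map_smul, map_one, smul_eq_mul, mul_one]
  rfl

variable [Module.Finite ℝ A]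

theorem toResidues_surjective : Function.Surjective (toResidues A) := by
  have : IsArtinianRing A := IsArtinianRing.of_finite ℝ A
  intro x
  obtain ⟨r, hr⟩ := Ideal.pi_quotient_surjective
    (fun (m : MaximalSpectrum A) m' hne => m.isCoprime_of_ne hne) x
  exact ⟨r, funext hr⟩

/-- In an Artinian ring the intersection of the maximal ideals is the nilradical. -/
theorem isNilpotent_of_toResidues_eq_zero {a : A} (h : toResidues A a = 0) : IsNilpotent a := by
  have : IsArtinianRing A := IsArtinianRing.of_finite ℝ A
  rw [← mem_nilradical, IsArtinianRing.nilradical_eq_iInf, Submodule.mem_iInf]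
  intro m
  have := congrFun h m
  rwa [toResidues_apply, Pi.zero_apply, Ideal.Quotient.eq_zero_iff_mem] at this

theorem trace_eq_zero_of_toResidues_eq_zero {a : A} (h : toResidues A a = 0) :
    Algebra.trace ℝ A a = 0 :=
  (Algebra.isNilpotent_trace_of_isNilpotent (isNilpotent_of_toResidues_eq_zero A h)).eq_zero

/-- Idempotents lift along a surjection with nil kernel. The lift picks out the local factor of `A`
at `m`. -/
theorem exists_idempotent_toResidues [DecidableEq (MaximalSpectrum A)] (m : MaximalSpectrum A) :
    ∃ e : A, IsIdempotentElem e ∧ toResidues A e = Pi.single m 1 := by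
  refine exists_isIdempotentElem_eq_of_ker_isNilpotent (toResidues A).toRingHom
    (fun x hx => isNilpotent_of_toResidues_eq_zero A hx) (Pi.single m 1)
    (toResidues_surjective A _) ?_
  simp [IsIdempotentElem, ← Pi.single_mul]

/-- The trace factors through the product of the residue fields, and is positive on each of the
primitive idempotents. -/
theorem exists_trace_eq_comp_toResidues [DecidableEq (MaximalSpectrum A)] :
    ∃ l : (∀ m : MaximalSpectrum A, A ⧸ m.asIdeal) →ₗ[ℝ] ℝ,
      (∀ a, l (toResidues A a) = Algebra.trace ℝ A a) ∧ ∀ m, 0 < l (Pi.single m 1) := by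
  -- Any linear section will do: two preimages differ by a nilpotent, which the trace does not see.
  obtain ⟨s, hs⟩ := (toResidues A).toLinearMap.exists_rightInverse_of_surjective
    (LinearMap.range_eq_top.mpr (toResidues_surjective A))
  have hl : ∀ a, (Algebra.trace ℝ A ∘ₗ s) (toResidues A a) = Algebra.trace ℝ A a := by
    intro a
    rw [LinearMap.comp_apply, ← sub_eq_zero, ← map_sub]
    apply trace_eq_zero_of_toResidues_eq_zero
    rw [map_sub, sub_eq_zero]
    exact LinearMap.congr_fun hs (toResidues A a)
  refine ⟨Algebra.trace ℝ A ∘ₗ s, hl, fun m => ?_⟩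
  obtain ⟨e, he, hem⟩ := exists_idempotent_toResidues A m
  rw [← hem, hl, Algebra.trace_apply]
  have he' : IsIdempotentElem (LinearMap.mulLeft ℝ e) := by
    ext x
    simp [← mul_assoc, he.eq]
  have hmul : Algebra.lmul ℝ A e = LinearMap.mulLeft ℝ e := rfl
  -- The trace of a projection is its rank, a natural number; it is nonzero because `e` has a
  -- nonzero residue at `m`.
  have hne : LinearMap.trace ℝ A (LinearMap.mulLeft ℝ e) ≠ 0 := by
    intro h
    have h0 := LinearMap.congr_fun (LinearMap.IsIdempotentElem.eq_zero_of_trace_eq_zero he' h) 1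
    simp only [LinearMap.mulLeft_apply, mul_one, LinearMap.zero_apply] at h0
    rw [h0, map_zero] at hem
    have := congrFun hem m
    simp only [Pi.zero_apply, Pi.single_eq_same] at this
    exact residue_ne_zero A m this.symm
  rw [hmul]
  rw [(LinearMap.IsIdempotentElem.isProj_range _ he').trace] at hne ⊢
  exact lt_of_le_of_ne (Nat.cast_nonneg _) hne.symm

theorem finite_algHom : Finite (A →ₐ[ℝ] ℝ) := by
  have : IsArtinianRing A := IsArtinianRing.of_finite ℝ A
  exact Finite.of_injective _ (kerSpectrum_injective A)

/-- A residue field is a finite extension of `ℝ`, hence `ℝ` or `ℂ`; in the first case `m` would be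
the kernel of a real character. -/
theorem exists_sq_eq_neg_one_of_notMem_range (m : MaximalSpectrum A)
    (hm : m ∉ Set.range (kerSpectrum A)) : ∃ j : A ⧸ m.asIdeal, j * j = -1 := by
  have := m.isMaximal
  let _ : Field (A ⧸ m.asIdeal) := Ideal.Quotient.field m.asIdeal
  obtain ⟨⟨e⟩⟩ | ⟨⟨e⟩⟩ := Real.nonempty_algEquiv_or (A ⧸ m.asIdeal)
  · refine absurd ⟨(e : (A ⧸ m.asIdeal) →ₐ[ℝ] ℝ).comp (Ideal.Quotient.mkₐ ℝ m.asIdeal), ?_⟩ hm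
    ext a
    simp [kerSpectrum, RingHom.mem_ker, Ideal.Quotient.eq_zero_iff_mem]
  · exact ⟨e.symm Complex.I, e.injective (by simp)⟩

/-- The signature of the trace form `h ↦ t(a h²)` of a finite real algebra counts its real
characters with the sign of `a`. -/
theorem signature_traceQuad (a : A) :
    signature (traceQuad a) = ∑ᶠ φ : A →ₐ[ℝ] ℝ, (SignType.sign (φ a) : ℤ) := by
  classical
  have : IsArtinianRing A := IsArtinianRing.of_finite ℝ A
  have := finite_algHom A
  have := Fintype.ofFinite (A →ₐ[ℝ] ℝ)
  have := Fintype.ofFinite (MaximalSpectrum A)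
  obtain ⟨l, hl, hpos⟩ := exists_trace_eq_comp_toResidues A
  let L (m : MaximalSpectrum A) : (A ⧸ m.asIdeal) →ₗ[ℝ] ℝ :=
    l ∘ₗ LinearMap.single ℝ (fun m : MaximalSpectrum A => A ⧸ m.asIdeal) m ∘ₗ
      LinearMap.mulLeft ℝ (Ideal.Quotient.mk m.asIdeal a)
  have hL : ∀ m x, L m x = l (Pi.single m (Ideal.Quotient.mk m.asIdeal a * x)) :=
    fun m x => rfl
  have hQ : traceQuad a =
      (QuadraticMap.pi fun m => functionalQuad (L m)).comp (toResidues A).toLinearMap := by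
    ext h
    rw [traceQuad_apply, ← hl, QuadraticMap.comp_apply, QuadraticMap.pi_apply]
    simp only [functionalQuad_apply, hL]
    rw [← map_sum]
    congr 1
    ext m
    rw [Finset.sum_apply, Fintype.sum_eq_single m fun m' hm => Pi.single_eq_of_ne hm.symm _,
      Pi.single_eq_same]
    simp [toResidues_apply, pow_two]
  rw [hQ, signature_comp_of_surjective _ _ (toResidues_surjective A), signature_pi,
    finsum_eq_sum_of_fintype,
    ← Finset.sum_subset (Finset.subset_univ (Finset.univ.image (kerSpectrum A))),
    Finset.sum_image fun _ _ _ _ h => kerSpectrum_injective A h]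
  · refine Finset.sum_congr rfl fun φ _ => ?_
    rw [signature_functionalQuad_of_algEquiv _ (residueEquiv A φ), hL, mul_one, mk_kerSpectrum,
      Pi.single_smul, map_smul, smul_eq_mul, sign_mul, sign_pos (hpos _), mul_one]
  · intro m _ hm
    obtain ⟨j, hj⟩ := exists_sq_eq_neg_one_of_notMem_range A m (by simpa using hm)
    exact signature_functionalQuad_of_sq_eq_neg_one _ j hj

/-- If the trace form `h ↦ t(a h²)` is nondegenerate, no real character vanishes at `a`. -/
theorem algHom_ne_zero_of_nondegenerate (a : A)
    (h : (QuadraticMap.associated (traceQuad a)).Nondegenerate) (φ : A →ₐ[ℝ] ℝ) : φ a ≠ 0 := by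
  classical
  intro h0
  obtain ⟨e, -, he⟩ := exists_idempotent_toResidues A (kerSpectrum A φ)
  have hB : ∀ x y, QuadraticMap.associated (traceQuad a) x y = Algebra.trace ℝ A (a * x * y) := by
    intro x y
    have h2 : a * (x + y) ^ 2 = a * x ^ 2 + a * y ^ 2 + 2 • (a * x * y) := by
      ring
    have h3 := LinearMap.congr_fun₂ (QuadraticMap.two_nsmul_associated ℝ (traceQuad a)) x y
    simp only [QuadraticMap.polarBilin_apply_apply, QuadraticMap.polar, traceQuad_apply, h2,
      map_add, map_nsmul, LinearMap.smul_apply] at h3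
    simp only [nsmul_eq_mul, Nat.cast_ofNat] at h3
    linarith
  -- If `φ a = 0`, then `a e y` vanishes in every residue field: at `ker φ` because of `a`,
  -- elsewhere because of `e`. So `e` lies in the radical of the form.
  have hz : e = 0 := by
    refine h.1 e fun y => ?_
    rw [hB]
    apply trace_eq_zero_of_toResidues_eq_zero
    ext m
    rw [map_mul, map_mul, he]
    by_cases hm : m = kerSpectrum A φ
    · subst hm
      simp [toResidues_apply, mk_kerSpectrum, h0]
    · simp [Pi.single_eq_of_ne hm]
  have := congrFun he (kerSpectrum A φ)
  rw [hz, map_zero, Pi.zero_apply, Pi.single_eq_same] at this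
  exact residue_ne_zero A _ this.symm

end TraceForm

/-! ### Polynomial functions and polynomial vector fields -/

/-- The function on `ℝ³` given by a polynomial. -/
def polyFun (u : R3) (p : E3) : ℝ := eval (fun j => p j) u

theorem polyFun_mul (u v : R3) (p : E3) : polyFun (u * v) p = polyFun u p * polyFun v p := by
  simp [polyFun]

theorem polyMap_apply (k : Fin 3 → R3) (p : E3) (i : Fin 3) :
    polyMap k p i = polyFun (k i) p := rfl

theorem hasGradientAt_polyFun (u : R3) (p : E3) :
    HasGradientAt (polyFun u) (polyMap (grad u) p) p := by
  induction u using MvPolynomial.induction_on with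
  | C a =>
    have h : polyMap (grad (C a)) p = 0 := by
      ext i
      simp [polyMap_apply, grad, polyFun]
    have h' : polyFun (C a) = fun _ => a := by
      ext q
      simp [polyFun]
    rw [h, h']
    exact hasGradientAt_const p a
  | add u v hu hv =>
    rw [hasGradientAt_iff_hasFDerivAt] at *
    have h : polyFun (u + v) = polyFun u + polyFun v := by
      ext q
      simp [polyFun]
    have h' : polyMap (grad (u + v)) p = polyMap (grad u) p + polyMap (grad v) p := by
      ext i
      simp [polyMap_apply, grad, polyFun]
    rw [h, h', map_add]
    exact hu.add hv
  | mul_X u i hu =>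
    rw [hasGradientAt_iff_hasFDerivAt] at *
    have h : polyFun (u * X i) = fun q => polyFun u q * q i := by
      ext q
      simp [polyFun]
    have hi : HasFDerivAt (fun q : E3 => q i) (EuclideanSpace.proj (𝕜 := ℝ) i) p :=
      (EuclideanSpace.proj (𝕜 := ℝ) i).hasFDerivAt
    rw [h]
    refine (hu.mul hi).congr_fderiv ?_
    ext v
    simp only [add_apply, smul_apply,
      InnerProductSpace.toDual_apply_apply, smul_eq_mul, PiLp.inner_apply, polyMap_apply, grad,
      PiLp.proj_apply]
    rw [Finset.mul_sum]
    have : ∀ j, inner ℝ (polyFun ((pderiv j) (u * X i)) p) (v j) =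
        p i * inner ℝ (polyFun (pderiv j u) p) (v j) + if j = i then polyFun u p * v j else 0 := by
      intro j
      by_cases hij : j = i
      · subst hij
        simp [polyFun, Derivation.leibniz]
        ring
      · simp [polyFun, Derivation.leibniz, pderiv_X, hij, Ne.symm hij]
        ring
    rw [Finset.sum_congr rfl fun j _ => this j, Finset.sum_add_distrib]
    simp
    ring

theorem gradient_polyFun (u : R3) (p : E3) : ∇ (polyFun u) p = polyMap (grad u) p :=
  (hasGradientAt_polyFun u p).gradient

theorem contDiff_polyFun (u : R3) {n : WithTop ℕ∞} : ContDiff ℝ n (polyFun u) := by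
  induction u using MvPolynomial.induction_on with
  | C a =>
    have h' : polyFun (C a) = fun _ => a := by
      ext q
      simp [polyFun]
    rw [h']
    exact contDiff_const
  | add u v hu hv =>
    have h : polyFun (u + v) = polyFun u + polyFun v := by
      ext q
      simp [polyFun]
    rw [h]
    exact hu.add hv
  | mul_X u i hu =>
    have h : polyFun (u * X i) = fun q => polyFun u q * q i := by
      ext q
      simp [polyFun]
    rw [h]
    exact hu.mul (EuclideanSpace.proj (𝕜 := ℝ) i).contDiff

theorem contDiff_polyMap (k : Fin 3 → R3) {n : WithTop ℕ∞} : ContDiff ℝ n (polyMap k) :=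
  contDiff_euclidean.mpr fun i => contDiff_polyFun (k i)

theorem inner_polyMap (k l : Fin 3 → R3) (p : E3) :
    inner ℝ (polyMap k p) (polyMap l p) = polyFun (k ⬝ᵥ l) p := by
  simp [PiLp.inner_apply, polyMap_apply, dotProduct, polyFun, mul_comm]

theorem along_polyFun (k : Fin 3 → R3) (u : R3) :
    along (polyMap k) (polyFun u) = polyFun (grad u ⬝ᵥ k) := by
  ext p
  rw [along, gradient_polyFun, inner_polyMap]

/-! ### Maps with given component gradients -/

theorem inner_gradient_eq_fderiv {u : E3 → ℝ} {p : E3} (v : E3) :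
    inner ℝ (∇ u p) v = fderiv ℝ u p v := by
  rw [gradient, InnerProductSpace.toDual_symm_apply]

theorem fderiv_apply_of_components {n : ℕ} {F : E3 → EuclideanSpace ℝ (Fin n)} {p : E3}
    (h : ∀ i, DifferentiableAt ℝ (fun q => F q i) p) (v : E3) (i : Fin n) :
    fderiv ℝ F p v i = inner ℝ (∇ (fun q => F q i) p) v := by
  have hF : DifferentiableAt ℝ F p := differentiableAt_euclidean.mpr h
  have h1 := ((EuclideanSpace.proj (𝕜 := ℝ) i).hasFDerivAt (x := F p)).comp p hF.hasFDerivAt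
  rw [inner_gradient_eq_fderiv]
  have h2 : fderiv ℝ (fun q => F q i) p = _ := h1.fderiv
  rw [h2]
  rfl

theorem det_of_rows (L : E3 →L[ℝ] E3) (G : Fin 3 → E3) (h : ∀ v i, L v i = inner ℝ (G i) v) :
    L.det = (Matrix.of fun i j => G i j).det := by
  rw [ContinuousLinearMap.det, ← LinearMap.det_toMatrix (EuclideanSpace.basisFun (Fin 3) ℝ).toBasis]
  congr 1
  ext i j
  rw [LinearMap.toMatrix_apply]
  simp [h, PiLp.inner_apply]

theorem fderiv_polyMap_apply (f : Fin 3 → R3) (p v : E3) (i : Fin 3) :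
    fderiv ℝ (polyMap f) p v i = inner ℝ (polyMap (grad (f i)) p) v := by
  rw [fderiv_apply_of_components]
  · exact congrArg (fun w => inner ℝ w v) (gradient_polyFun (f i) p)
  · exact fun i => (contDiff_polyFun (f i) (n := 1)).differentiable one_ne_zero p

theorem polyFun_det (M : Matrix (Fin 3) (Fin 3) R3) (p : E3) :
    polyFun M.det p = (Matrix.of fun i j => polyFun (M i j) p).det := by
  rw [polyFun, RingHom.map_det]
  rfl

theorem jacobian_polyMap (f : Fin 3 → R3) : jacobian (polyMap f) = polyFun (polyJ f) := by
  ext p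
  rw [jacobian, det_of_rows _ (fun i => polyMap (grad (f i)) p) fun v i =>
    fderiv_polyMap_apply f p v i, polyJ, polyFun_det]
  rfl

/-! ### Tangent spaces of zero sets of submersions -/

/-- Velocities lie in the kernel by the chain rule; conversely, the inverse function theorem
realizes each kernel vector by a curve in `S`. Regularity `ω` is used because, unlike `∞`, it
spreads from a point to a neighbourhood, as `tangentTo` demands of its curves. -/
theorem tangentTo_eq_ker {c : ℕ} {S U : Set E3} {F : E3 → EuclideanSpace ℝ (Fin c)} {p : E3}
    (hU : IsOpen U) (hpU : p ∈ U) (hF : ContDiffAt ℝ ω F p)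
    (hsurj : Function.Surjective (fderiv ℝ F p)) (hpS : p ∈ S)
    (hS : S ∩ U = {q ∈ U | F q = 0}) :
    tangentTo S p = LinearMap.ker (fderiv ℝ F p : E3 →ₗ[ℝ] EuclideanSpace ℝ (Fin c)) := by
  have hmem : ∀ q ∈ U, (q ∈ S ↔ F q = 0) := by
    intro q hq
    have := Set.ext_iff.mp hS q
    simpa [hq] using this
  have hFp : F p = 0 := (hmem p hpU).mp hpS
  have hFd : HasFDerivAt F (fderiv ℝ F p) p := (hF.differentiableAt (by simp)).hasFDerivAt
  apply le_antisymm
  · refine Submodule.span_le.mpr ?_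
    rintro v ⟨γ, h0, hγ, rfl⟩
    have hγd : HasDerivAt γ (deriv γ 0) 0 :=
      (hγ.self_of_nhds.1.differentiableAt (by simp)).hasDerivAt
    have hcomp : HasDerivAt (F ∘ γ) (fderiv ℝ F p (deriv γ 0)) 0 :=
      HasFDerivAt.comp_hasDerivAt 0 (by rwa [h0]) hγd
    have hz : F ∘ γ =ᶠ[𝓝 0] fun _ => 0 := by
      have hUγ : ∀ᶠ t in 𝓝 (0 : ℝ), γ t ∈ U :=
        hγd.continuousAt.eventually_mem (by rw [h0]; exact hU.mem_nhds hpU)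
      filter_upwards [hγ, hUγ] with t ht htU
      exact (hmem _ htU).mp ht.2
    exact hcomp.unique ((hasDerivAt_const 0 0).congr_of_eventuallyEq hz)
  · intro v hv
    refine Submodule.subset_span ?_
    have hv : fderiv ℝ F p v = 0 := hv
    obtain ⟨R, hR⟩ := (fderiv ℝ F p).exists_rightInverse_of_surjective
      (LinearMap.range_eq_top.mpr hsurj)
    have hR : ∀ y, fderiv ℝ F p (R y) = y := fun y => congrArg (fun L => L y) hR
    let A : ℝ × EuclideanSpace ℝ (Fin c) →L[ℝ] E3 :=
      (ContinuousLinearMap.toSpanSingleton ℝ v).coprod R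
    have hA : ∀ x, A x = x.1 • v + R x.2 := fun x => by simp [A]
    -- With `R` a right inverse of `DF(p)` and `DF(p) v = 0`, the map `(t, y) ↦ (t, F(p + t v + R
    -- y))` has derivative the identity at 0. Its local inverse along `(t, 0)` gives the curve, with
    -- velocity `v`.
    let G : ℝ × EuclideanSpace ℝ (Fin c) → ℝ × EuclideanSpace ℝ (Fin c) :=
      fun x => (x.1, F (p + A x))
    have hG0 : G 0 = 0 := by simp [G, hFp]
    have hpA : p + A 0 = p := by simp
    have hGc : ContDiffAt ℝ ω G 0 := by
      refine contDiffAt_fst.prodMk (ContDiffAt.comp 0 ?_ (contDiffAt_const.add A.contDiff.contDiffAt))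
      rwa [hpA]
    have hGd : HasFDerivAt G ((ContinuousLinearEquiv.refl ℝ (ℝ × EuclideanSpace ℝ (Fin c)) :
        (ℝ × EuclideanSpace ℝ (Fin c)) ≃L[ℝ] (ℝ × EuclideanSpace ℝ (Fin c))) :
        (ℝ × EuclideanSpace ℝ (Fin c)) →L[ℝ] (ℝ × EuclideanSpace ℝ (Fin c))) 0 := by
      have h1 : HasFDerivAt (fun x => F (p + A x)) ((fderiv ℝ F p).comp A) 0 :=
        HasFDerivAt.comp 0 (by rwa [hpA]) (A.hasFDerivAt.const_add p)
      refine (hasFDerivAt_fst.prodMk h1).congr_fderiv ?_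
      refine ContinuousLinearMap.ext fun x => ?_
      simp [hA, hv, hR]
    let g := hGc.localInverse hGd (by simp)
    have hgc : ContDiffAt ℝ ω g 0 := by
      have := hGc.to_localInverse hGd (by simp)
      rwa [hG0] at this
    have hst := hGc.hasStrictFDerivAt' hGd (by simp)
    have hg0 : g 0 = 0 := by
      have := hst.localInverse_apply_image
      rwa [hG0] at this
    have hgd : HasFDerivAt g ((ContinuousLinearEquiv.refl ℝ (ℝ × EuclideanSpace ℝ (Fin c)) :
        (ℝ × EuclideanSpace ℝ (Fin c)) ≃L[ℝ] (ℝ × EuclideanSpace ℝ (Fin c))) :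
        (ℝ × EuclideanSpace ℝ (Fin c)) →L[ℝ] (ℝ × EuclideanSpace ℝ (Fin c))) 0 := by
      have := hst.to_localInverse.hasFDerivAt
      rwa [hG0] at this
    have hgr : ∀ᶠ y in 𝓝 (0 : ℝ × EuclideanSpace ℝ (Fin c)), G (g y) = y := by
      have := hst.eventually_right_inverse
      rwa [hG0] at this
    let ι : ℝ →L[ℝ] ℝ × EuclideanSpace ℝ (Fin c) := ContinuousLinearMap.inl ℝ ℝ _
    have hι : ∀ t, ι t = (t, 0) := fun t => rfl
    have hι0 : ι 0 = 0 := map_zero ι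
    let γ : ℝ → E3 := fun t => p + A (g (ι t))
    have hγ0 : γ 0 = p := by simp [γ, hg0]
    have hγc : ContDiffAt ℝ ω γ 0 := by
      refine contDiffAt_const.add (A.contDiff.contDiffAt.comp 0 (ContDiffAt.comp 0 ?_
        ι.contDiff.contDiffAt))
      rwa [hι0]
    refine ⟨γ, hγ0, ?_, ?_⟩
    · have h1 := hγc.eventually (by simp)
      have h2 : ∀ᶠ t in 𝓝 (0 : ℝ), γ t ∈ U :=
        hγc.continuousAt.eventually_mem (by rw [hγ0]; exact hU.mem_nhds hpU)
      have h3 : ∀ᶠ t in 𝓝 (0 : ℝ), G (g (ι t)) = ι t := by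
        have hc : Filter.Tendsto ι (𝓝 0) (𝓝 0) := by
          simpa [hι0] using ι.continuous.tendsto 0
        exact hc.eventually hgr
      filter_upwards [h1, h2, h3] with t ht htU htG
      refine ⟨ht.of_le le_top, (hmem _ htU).mpr ?_⟩
      exact congrArg Prod.snd htG
    · have hgι : HasFDerivAt g (ContinuousLinearMap.id ℝ (ℝ × EuclideanSpace ℝ (Fin c))) (ι 0) := by
        rw [hι0]
        exact hgd
      have h1 : HasDerivAt (fun t => g (ι t)) (ι 1) 0 := hgι.comp_hasDerivAt 0 ι.hasDerivAt
      have h2 : HasDerivAt γ (A (ι 1)) 0 :=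
        (A.hasFDerivAt.comp_hasDerivAt 0 h1).const_add p
      rw [h2.deriv, hA, hι]
      simp

/-! ### Smooth functions near a point and their gradients -/

/-- `u` is smooth in a neighbourhood of `p`. -/
def SmoothNear {F : Type*} [NormedAddCommGroup F] [NormedSpace ℝ F] (u : E3 → F) (p : E3) : Prop :=
  ∀ᶠ q in 𝓝 p, ContDiffAt ℝ ∞ u q

theorem _root_.ContDiff.smoothNear {F : Type*} [NormedAddCommGroup F] [NormedSpace ℝ F]
    {u : E3 → F} (h : ContDiff ℝ ∞ u) (p : E3) : SmoothNear u p :=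
  Filter.Eventually.of_forall fun _ => h.contDiffAt

namespace SmoothNear

variable {F : Type*} [NormedAddCommGroup F] [NormedSpace ℝ F] {u v : E3 → ℝ} {K L : E3 → E3}
  {p : E3}

theorem eventually {w : E3 → F} (h : SmoothNear w p) : ∀ᶠ q in 𝓝 p, SmoothNear w q :=
  eventually_eventually_nhds.mpr h

theorem contDiffAt {w : E3 → F} (h : SmoothNear w p) : ContDiffAt ℝ ∞ w p := h.self_of_nhds

theorem differentiableAt {w : E3 → F} (h : SmoothNear w p) : DifferentiableAt ℝ w p :=
  h.contDiffAt.differentiableAt (by simp)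

theorem gradient (h : SmoothNear u p) : SmoothNear (∇ u) p := by
  filter_upwards [h] with q hq
  exact (InnerProductSpace.toDual ℝ E3).symm.contDiff.contDiffAt.comp q
    (hq.fderiv_right (m := ∞) (by simp))

theorem inner (hK : SmoothNear K p) (hL : SmoothNear L p) :
    SmoothNear (fun q => inner ℝ (K q) (L q)) p := by
  filter_upwards [hK, hL] with q h1 h2
  exact h1.inner ℝ h2

theorem along (hK : SmoothNear K p) (hu : SmoothNear u p) : SmoothNear (along K u) p :=
  hu.gradient.inner hK

theorem add (hu : SmoothNear u p) (hv : SmoothNear v p) : SmoothNear (fun q => u q + v q) p := by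
  filter_upwards [hu, hv] with q h1 h2
  exact h1.add h2

theorem mul (hu : SmoothNear u p) (hv : SmoothNear v p) : SmoothNear (fun q => u q * v q) p := by
  filter_upwards [hu, hv] with q h1 h2
  exact h1.mul h2

theorem sub (hK : SmoothNear K p) (hL : SmoothNear L p) : SmoothNear (fun q => K q - L q) p := by
  filter_upwards [hK, hL] with q h1 h2
  exact h1.sub h2

theorem div (hu : SmoothNear u p) (hv : SmoothNear v p) (hne : v p ≠ 0) :
    SmoothNear (fun q => u q / v q) p := by
  filter_upwards [hu, hv, hv.contDiffAt.continuousAt.eventually_ne hne] with q h1 h2 h3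
  exact h1.div h2 h3

end SmoothNear

theorem gradient_add {u v : E3 → ℝ} {p : E3} (hu : DifferentiableAt ℝ u p)
    (hv : DifferentiableAt ℝ v p) : ∇ (fun q => u q + v q) p = ∇ u p + ∇ v p := by
  refine HasGradientAt.gradient ?_
  rw [hasGradientAt_iff_hasFDerivAt, map_add]
  exact hu.hasGradientAt.hasFDerivAt.add hv.hasGradientAt.hasFDerivAt

theorem gradient_mul {u v : E3 → ℝ} {p : E3} (hu : DifferentiableAt ℝ u p)
    (hv : DifferentiableAt ℝ v p) :
    ∇ (fun q => u q * v q) p = u p • ∇ v p + v p • ∇ u p := by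
  refine HasGradientAt.gradient ?_
  rw [hasGradientAt_iff_hasFDerivAt, map_add]
  refine (hu.hasGradientAt.hasFDerivAt.mul hv.hasGradientAt.hasFDerivAt).congr_fderiv ?_
  simp

/-! ### Functions that agree on a hypersurface -/

/-- The multiple of `∇J` by which the gradients of `u` and `v` differ, if `u` and `v` agree on the
hypersurface `J = 0`. -/
def multiplier (J u v : E3 → ℝ) (q : E3) : ℝ :=
  inner ℝ (∇ u q - ∇ v q) (∇ J q) / inner ℝ (∇ J q) (∇ J q)

theorem SmoothNear.multiplier {J u v : E3 → ℝ} {p : E3} (hJ : SmoothNear J p)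
    (hu : SmoothNear u p) (hv : SmoothNear v p) (hne : ∇ J p ≠ 0) :
    SmoothNear (multiplier J u v) p :=
  ((hu.gradient.sub hv.gradient).inner hJ.gradient).div (hJ.gradient.inner hJ.gradient)
    (by simpa using hne)

/-- `u - v` is constant on the regular hypersurface `J = 0`, so every point of it is a constrained
extremum and Lagrange multipliers apply. The explicit formula for the multiplier makes it smooth, so
that the identity can be used for further differentiation. -/
theorem gradient_eq_add_multiplier {J u v : E3 → ℝ} {p : E3} (hJ : SmoothNear J p)
    (hu : SmoothNear u p) (hv : SmoothNear v p) (hJp : J p = 0) (hne : ∇ J p ≠ 0)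
    (heq : ∀ᶠ q in 𝓝 p, J q = 0 → u q = v q) :
    ∇ u p = ∇ v p + multiplier J u v p • ∇ J p := by
  have hd : ContDiffAt ℝ ∞ (fun q => u q - v q) p := hu.contDiffAt.sub hv.contDiffAt
  have hext : IsLocalExtrOn (fun q => u q - v q) {q | J q = J p} p := by
    left
    filter_upwards [mem_nhdsWithin_of_mem_nhds heq, self_mem_nhdsWithin] with q hq hq'
    have hq'' : J q = 0 := by rw [← hJp]; exact hq'
    simp [hq hq'', heq.self_of_nhds hJp]
  have hdg : HasStrictFDerivAt (fun q => u q - v q) (fderiv ℝ u p - fderiv ℝ v p) p :=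
    (hu.contDiffAt.hasStrictFDerivAt (by simp)).sub (hv.contDiffAt.hasStrictFDerivAt (by simp))
  obtain ⟨a, b, hab, h⟩ := hext.exists_multipliers_of_hasStrictFDerivAt_1d
    (hJ.contDiffAt.hasStrictFDerivAt (by simp)) hdg
  have h' : a • ∇ J p + b • (∇ u p - ∇ v p) = 0 := by
    refine ext_inner_right ℝ fun w => ?_
    have := congrArg (fun L : E3 →L[ℝ] ℝ => L w) h
    simpa [inner_add_left, inner_sub_left, inner_smul_left, inner_gradient_eq_fderiv] using this
  have hb : b ≠ 0 := by
    rintro rfl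
    have ha : a ≠ 0 := by
      rintro rfl
      exact hab rfl
    simp [ha, hne] at h'
  have h3 : ∇ u p - ∇ v p = (-a / b) • ∇ J p := by
    have h4 : b • (∇ u p - ∇ v p) = b • ((-a / b) • ∇ J p) := by
      rw [smul_smul, mul_div_cancel₀ _ hb, neg_smul]
      exact eq_neg_of_add_eq_zero_right h'
    exact smul_right_injective _ hb h4
  have hnn : inner ℝ (∇ J p) (∇ J p) ≠ (0 : ℝ) := by simpa using hne
  rw [multiplier, h3, inner_smul_left, mul_div_assoc, div_self hnn, mul_one]
  simp only [conj_trivial]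
  rw [← h3]
  abel

/-! ### Comparison of kernel fields -/

/-- From `K' = cK` on `J = 0` alone follow `X' = cX` and `Y' = c²Y + mX` there, with `m` smooth.
Each differentiation adds a multiple of `∇J`, which is harmless because `⟨∇J, K⟩ = X`. The factor
`c` may vanish. -/
theorem along_comparison {J c : E3 → ℝ} {K K' : E3 → E3} {p : E3} (hJ : ContDiff ℝ ∞ J)
    (hK : SmoothNear K p) (hK' : SmoothNear K' p) (hc : SmoothNear c p)
    (heq : ∀ᶠ q in 𝓝 p, J q = 0 → K' q = c q • K q) (hJp : J p = 0) (hne : ∇ J p ≠ 0)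
    (hX : along K J p = 0) :
    along K' J p = 0 ∧
    (∃ a : ℝ, ∇ (along K' J) p = c p • ∇ (along K J) p + a • ∇ J p) ∧
    along K' (along K' J) p = c p ^ 2 * along K (along K J) p ∧
    (along K (along K J) p = 0 →
      (∃ a b : ℝ, ∇ (along K' (along K' J)) p =
        c p ^ 2 • ∇ (along K (along K J)) p + a • ∇ (along K J) p + b • ∇ J p) ∧
      along K' (along K' (along K' J)) p = c p ^ 3 * along K (along K (along K J)) p) := by
  have hJs := fun q => hJ.smoothNear q
  set X := along K J with hXdef
  set X' := along K' J with hXdef'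
  have sX : SmoothNear X p := hK.along (hJs p)
  have sX' : SmoothNear X' p := hK'.along (hJs p)
  set Y := along K X with hYdef
  set Y' := along K' X' with hYdef'
  have sY : SmoothNear Y p := hK.along sX
  have sY' : SmoothNear Y' p := hK'.along sX'
  have e1 : ∀ᶠ q in 𝓝 p, J q = 0 → X' q = c q * X q := by
    filter_upwards [heq] with q hq h0
    rw [hXdef', hXdef, along, along, hq h0, inner_smul_right]
  set l := multiplier J X' fun q => c q * X q
  have sl : SmoothNear l p := (hJs p).multiplier sX' (hc.mul sX) hne
  have g1 : ∀ᶠ q in 𝓝 p, J q = 0 → ∇ X' q = c q • ∇ X q + X q • ∇ c q + l q • ∇ J q := by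
    filter_upwards [eventually_eventually_nhds.mpr e1, sX.eventually, sX'.eventually, hc.eventually,
      (hJs p).gradient.contDiffAt.continuousAt.eventually_ne hne] with q he h1 h2 h3 h4 h0
    rw [gradient_eq_add_multiplier (hJs q) h2 (h3.mul h1) h0 h4 he,
      gradient_mul h3.differentiableAt h1.differentiableAt]
  set m : E3 → ℝ := fun q => c q * (along K c q + l q)
  have sm : SmoothNear m p := hc.mul ((hK.along hc).add sl)
  have e2 : ∀ᶠ q in 𝓝 p, J q = 0 → Y' q = c q * (c q * Y q) + m q * X q := by
    filter_upwards [heq, g1] with q hq hg h0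
    rw [hYdef', along, hg h0, hq h0]
    simp only [m, hYdef, hXdef, along, inner_add_left, inner_smul_left, inner_smul_right,
      conj_trivial]
    ring
  have hY : Y' p = c p ^ 2 * Y p := by
    rw [e2.self_of_nhds hJp, hX]
    ring
  have gX : ∇ X' p = c p • ∇ X p + l p • ∇ J p := by
    rw [g1.self_of_nhds hJp, hX, zero_smul, add_zero]
  refine ⟨by rw [e1.self_of_nhds hJp, hX, mul_zero], ⟨_, gX⟩, hY, fun hY0 => ?_⟩
  have gY : ∇ Y' p = c p ^ 2 • ∇ Y p + m p • ∇ X p +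
      multiplier J Y' (fun q => c q * (c q * Y q) + m q * X q) p • ∇ J p := by
    rw [gradient_eq_add_multiplier (hJs p) sY' ((hc.mul (hc.mul sY)).add (sm.mul sX)) hJp hne e2,
      gradient_add (hc.mul (hc.mul sY)).differentiableAt (sm.mul sX).differentiableAt,
      gradient_mul hc.differentiableAt (hc.mul sY).differentiableAt,
      gradient_mul hc.differentiableAt sY.differentiableAt,
      gradient_mul sm.differentiableAt sX.differentiableAt, hX, hY0]
    simp [smul_smul, pow_two]
  refine ⟨⟨_, _, gY⟩, ?_⟩
  rw [along, gY, heq.self_of_nhds hJp]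
  have h1 : inner ℝ (∇ X p) (K p) = (0 : ℝ) := hY0
  have h2 : inner ℝ (∇ J p) (K p) = (0 : ℝ) := hX
  simp only [inner_add_left, inner_smul_left, inner_smul_right, conj_trivial, h1, h2]
  rw [along]
  ring

/-- On a line spanned by `k`, every vector is the multiple of `k` given by orthogonal
projection. -/
theorem eq_smul_of_corank_one {L : E3 →L[ℝ] E3} {k v : E3}
    (h : Module.finrank ℝ (LinearMap.range (L : E3 →ₗ[ℝ] E3)) = 2) (hk : k ≠ 0) (hLk : L k = 0)
    (hLv : L v = 0) : v = (inner ℝ k v / inner ℝ k k : ℝ) • k := by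
  have hker : Module.finrank ℝ (LinearMap.ker (L : E3 →ₗ[ℝ] E3)) = 1 := by
    have := LinearMap.finrank_range_add_finrank_ker (L : E3 →ₗ[ℝ] E3)
    rw [h, finrank_euclideanSpace_fin] at this
    omega
  obtain ⟨c, hc⟩ := (finrank_eq_one_iff_of_nonzero' (⟨k, hLk⟩ : LinearMap.ker (L : E3 →ₗ[ℝ] E3))
    (by simpa [Subtype.ext_iff] using hk)).mp hker ⟨v, hLv⟩
  have hc' : c • k = v := congrArg Subtype.val hc
  have hkk : inner ℝ k k ≠ (0 : ℝ) := by simpa using hk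
  rw [← hc', inner_smul_right, mul_div_assoc, div_self hkk, mul_one]

/-- `K` is smooth near `p` and lies in the kernel of `Df` along `S1 f`; it may vanish at `p`. -/
def IsWeakKernelField (f : E3 → E3) (p : E3) (K : E3 → E3) : Prop :=
  ∀ᶠ q in 𝓝 p, ContDiffAt ℝ ∞ K q ∧ (q ∈ S1 f → fderiv ℝ f q (K q) = 0)

theorem IsWeakKernelField.smoothNear {f : E3 → E3} {p : E3} {K : E3 → E3}
    (h : IsWeakKernelField f p K) : SmoothNear K p := h.mono fun _ hq => hq.1

/-- On `S1 f` the kernel is a line, so orthogonal projection to `K` gives the factor; its formula is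
smooth also off `S1 f`, since `K p ≠ 0`. -/
theorem IsKernelField.exists_proportional {f : E3 → E3} {p : E3} {K K' : E3 → E3}
    (hK : IsKernelField f p K) (hK' : IsWeakKernelField f p K') :
    ∃ c : E3 → ℝ, SmoothNear c p ∧ ∀ᶠ q in 𝓝 p, q ∈ S1 f → K' q = c q • K q := by
  have sK : SmoothNear K p := IsWeakKernelField.smoothNear hK.2
  refine ⟨fun q => inner ℝ (K q) (K' q) / inner ℝ (K q) (K q),
    (sK.inner hK'.smoothNear).div (sK.inner sK) (by simpa using hK.1), ?_⟩
  filter_upwards [hK.2, hK', sK.contDiffAt.continuousAt.eventually_ne hK.1] with q h1 h2 h3 hq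
  exact eq_smul_of_corank_one hq h3 (h1.2 hq) (h2.2 hq)

/-- The matrix with rows `∇J, ∇X, ∇Y`. -/
def gradMatrix (f K : E3 → E3) (p : E3) : Matrix (Fin 3) (Fin 3) ℝ :=
  Matrix.of fun i j =>
    (![∇ (jacobian f) p, ∇ (fieldX f K) p, ∇ (fieldY f K) p] : Fin 3 → E3) i j

theorem det_fderiv_fieldH {f K : E3 → E3} {p : E3} (hJ : ContDiff ℝ ∞ (jacobian f))
    (hK : SmoothNear K p) : (fderiv ℝ (fieldH f K) p).det = (gradMatrix f K p).det := by
  have sX : SmoothNear (fieldX f K) p := hK.along (hJ.smoothNear p)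
  have sY : SmoothNear (fieldY f K) p := hK.along sX
  refine det_of_rows _ _ fun v i => ?_
  rw [fderiv_apply_of_components]
  · fin_cases i <;> rfl
  · intro i
    fin_cases i
    · exact (hJ.smoothNear p).differentiableAt
    · exact sX.differentiableAt
    · exact sY.differentiableAt

theorem linearIndependent_iff_det_gradMatrix_ne_zero {f K : E3 → E3} {p : E3} :
    LinearIndependent ℝ ![∇ (jacobian f) p, ∇ (fieldX f K) p, ∇ (fieldY f K) p] ↔
      (gradMatrix f K p).det ≠ 0 := by
  rw [← isUnit_iff_ne_zero, ← Matrix.isUnit_iff_isUnit_det,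
    ← Matrix.linearIndependent_rows_iff_isUnit,
    ← LinearMap.linearIndependent_iff (WithLp.linearEquiv 2 ℝ (Fin 3 → ℝ)).toLinearMap
      (LinearEquiv.ker _)]
  rfl

/-- Comparison of the data of two kernel fields at a point of the surface `J = 0`, the first of
which does not vanish there. -/
theorem IsKernelField.comparison {f : E3 → E3} {p : E3} {K K' : E3 → E3}
    (hJ : ContDiff ℝ ∞ (jacobian f)) (hS : ∀ q, q ∈ S1 f ↔ jacobian f q = 0)
    (hK : IsKernelField f p K) (hK' : IsWeakKernelField f p K') (hp : p ∈ S1 f)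
    (hne : ∇ (jacobian f) p ≠ 0) (hX : fieldX f K p = 0) :
    ∃ c : ℝ, K' p = c • K p ∧ fieldX f K' p = 0 ∧
      (∃ a : ℝ, ∇ (fieldX f K') p = c • ∇ (fieldX f K) p + a • ∇ (jacobian f) p) ∧
      fieldY f K' p = c ^ 2 * fieldY f K p ∧
      (fieldY f K p = 0 → fieldZ f K' p * (fderiv ℝ (fieldH f K') p).det =
        c ^ 6 * (fieldZ f K p * (fderiv ℝ (fieldH f K) p).det)) := by
  obtain ⟨c, hc, heq⟩ := hK.exists_proportional hK'
  have sK : SmoothNear K p := IsWeakKernelField.smoothNear hK.2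
  simp only [hS] at heq
  obtain ⟨h1, ⟨a, ha⟩, h3, h4⟩ := along_comparison hJ sK hK'.smoothNear hc heq ((hS p).mp hp) hne hX
  refine ⟨c p, heq.self_of_nhds ((hS p).mp hp), h1, ⟨a, ha⟩, h3, fun hY => ?_⟩
  obtain ⟨⟨a', b', hab⟩, hZ⟩ := h4 hY
  rw [det_fderiv_fieldH hJ sK, det_fderiv_fieldH hJ hK'.smoothNear]
  have hZ' : fieldZ f K' p = c p ^ 3 * fieldZ f K p := hZ
  have ha' : ∇ (fieldX f K') p = c p • ∇ (fieldX f K) p + a • ∇ (jacobian f) p := ha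
  have hab' : ∇ (fieldY f K') p =
    c p ^ 2 • ∇ (fieldY f K) p + a' • ∇ (fieldX f K) p + b' • ∇ (jacobian f) p := hab
  -- The change of rows is triangular with diagonal `1, c, c²`.
  have hdet : (gradMatrix f K' p).det = c p ^ 3 * (gradMatrix f K p).det := by
    simp only [Matrix.det_fin_three, gradMatrix, ha', hab', Matrix.of_apply, Matrix.cons_val_zero,
      Matrix.cons_val_one, Matrix.cons_val, PiLp.add_apply, PiLp.smul_apply, smul_eq_mul]
    ring
  rw [hZ', hdet]
  ring

/-- A nondegenerate kernel field shows that `p` is a simple swallowtail point, and computes its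
sign. -/
theorem IsKernelField.swallowtailSign_eq {f : E3 → E3} {p : E3} {K : E3 → E3}
    (hJ : ContDiff ℝ ∞ (jacobian f)) (hS : ∀ q, q ∈ S1 f ↔ jacobian f q = 0)
    (hK : IsKernelField f p K) (hp : p ∈ S1 f) (hne : ∇ (jacobian f) p ≠ 0)
    (hX : fieldX f K p = 0) (hY : fieldY f K p = 0)
    (hZ : fieldZ f K p * (fderiv ℝ (fieldH f K) p).det ≠ 0) :
    IsSimpleSwallowtail f p ∧ swallowtailSign f p =
      SignType.sign (fieldZ f K p * (fderiv ℝ (fieldH f K) p).det) := by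
  have sK : SmoothNear K p := IsWeakKernelField.smoothNear hK.2
  have hsimple : IsSimpleSwallowtail f p := by
    refine ⟨hp, K, hK, (hS p).mp hp, hX, hY, ?_⟩
    rw [linearIndependent_iff_det_gradMatrix_ne_zero, ← det_fderiv_fieldH hJ sK]
    exact right_ne_zero_of_mul hZ
  refine ⟨hsimple, ?_⟩
  rw [swallowtailSign, dif_pos hsimple]
  have hK' := hsimple.2.choose_spec.1
  -- The field chosen in the definition of the sign does not vanish at `p`, so `c ≠ 0` and the
  -- factor `c⁶` is positive.
  obtain ⟨c, hc, -, -, -, h⟩ := hK.comparison hJ hS hK'.2 hp hne hX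
  have hc0 : c ≠ 0 := by
    rintro rfl
    exact hK'.1 (by rw [hc, zero_smul])
  rw [h hY, sign_mul, sign_pos (by positivity), one_mul]

/-! ### Sets cut out by polynomial equations with independent gradients -/

/-- The map to `ℝᶜ` given by polynomials. -/
def polyTuple {c : ℕ} (u : Fin c → R3) (p : E3) : EuclideanSpace ℝ (Fin c) :=
  WithLp.toLp 2 fun i => polyFun (u i) p

theorem contDiff_polyTuple {c : ℕ} (u : Fin c → R3) {n : WithTop ℕ∞} :
    ContDiff ℝ n (polyTuple u) :=
  contDiff_euclidean.mpr fun i => contDiff_polyFun (u i)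

theorem fderiv_polyTuple_apply {c : ℕ} (u : Fin c → R3) (p v : E3) (i : Fin c) :
    fderiv ℝ (polyTuple u) p v i = inner ℝ (polyMap (grad (u i)) p) v := by
  rw [fderiv_apply_of_components]
  · exact congrArg (fun w => inner ℝ w v) (gradient_polyFun (u i) p)
  · exact fun i => (contDiff_polyFun (u i) (n := 1)).differentiable one_ne_zero p

/-- If `y` is orthogonal to the range, then `w = ∑ yᵢ ∇uᵢ` satisfies `⟨w, w⟩ = ⟨Du(w), y⟩ = 0`, and
independence gives `y = 0`. -/
theorem surjective_fderiv_polyTuple {c : ℕ} {u : Fin c → R3} {p : E3}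
    (h : LinearIndependent ℝ fun i => polyMap (grad (u i)) p) :
    Function.Surjective (fderiv ℝ (polyTuple u) p) := by
  have key : LinearMap.range
      (fderiv ℝ (polyTuple u) p : E3 →ₗ[ℝ] EuclideanSpace ℝ (Fin c)) = ⊤ := by
    rw [← Submodule.orthogonal_eq_bot_iff, Submodule.eq_bot_iff]
    intro y hy
    set w := ∑ i, y i • polyMap (grad (u i)) p with hw
    have h1 : inner ℝ (fderiv ℝ (polyTuple u) p w) y = (0 : ℝ) := hy _ ⟨w, rfl⟩
    have h2 : inner ℝ w w = (0 : ℝ) := by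
      rw [← h1, PiLp.inner_apply (fderiv ℝ (polyTuple u) p w) y]
      nth_rewrite 1 [hw]
      rw [sum_inner]
      refine Finset.sum_congr rfl fun i _ => ?_
      rw [fderiv_polyTuple_apply, inner_smul_left]
      simp
    have h3 : w = 0 := inner_self_eq_zero.mp h2
    ext i
    exact Fintype.linearIndependent_iff.mp h (fun i => y i) h3 i
  exact LinearMap.range_eq_top.mp key

/-- Near `p`, the set `S` is cut out by the equations `u i = 0`, whose gradients at `p` are
linearly independent. -/
structure IsCutOutBy {c : ℕ} (S : Set E3) (p : E3) (U : Set E3) (u : Fin c → R3) : Prop where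
  isOpen : IsOpen U
  mem : p ∈ U
  mem_iff : ∀ q ∈ U, q ∈ S ↔ ∀ i, polyFun (u i) q = 0
  linearIndependent : LinearIndependent ℝ fun i => polyMap (grad (u i)) p

namespace IsCutOutBy

variable {c : ℕ} {S U : Set E3} {p : E3} {u : Fin c → R3}

theorem inter_eq (h : IsCutOutBy S p U u) : S ∩ U = {q ∈ U | polyTuple u q = 0} := by
  ext q
  have : polyTuple u q = 0 ↔ ∀ i, polyFun (u i) q = 0 := by
    rw [PiLp.ext_iff]
    rfl
  simp only [Set.mem_inter_iff, Set.mem_ofPred_eq, this]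
  constructor
  · exact fun ⟨hS, hU⟩ => ⟨hU, (h.mem_iff q hU).mp hS⟩
  · exact fun ⟨hU, hS⟩ => ⟨(h.mem_iff q hU).mpr hS, hU⟩

theorem tangentTo_eq (h : IsCutOutBy S p U u) (hp : p ∈ S) : tangentTo S p =
    LinearMap.ker (fderiv ℝ (polyTuple u) p : E3 →ₗ[ℝ] EuclideanSpace ℝ (Fin c)) :=
  tangentTo_eq_ker h.isOpen h.mem (contDiff_polyTuple u).contDiffAt
    (surjective_fderiv_polyTuple h.linearIndependent) hp h.inter_eq

theorem mem_tangentTo (h : IsCutOutBy S p U u) (hp : p ∈ S) (v : E3) :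
    v ∈ tangentTo S p ↔ ∀ i, inner ℝ (polyMap (grad (u i)) p) v = (0 : ℝ) := by
  rw [h.tangentTo_eq hp, LinearMap.mem_ker, PiLp.ext_iff]
  refine forall_congr' fun i => ?_
  rw [← fderiv_polyTuple_apply]
  rfl

theorem finrank_tangentTo (h : IsCutOutBy S p U u) (hp : p ∈ S) :
    Module.finrank ℝ (tangentTo S p) + c = 3 := by
  have := LinearMap.finrank_range_add_finrank_ker
    (fderiv ℝ (polyTuple u) p : E3 →ₗ[ℝ] EuclideanSpace ℝ (Fin c))
  rw [LinearMap.range_eq_top.mpr (surjective_fderiv_polyTuple h.linearIndependent), finrank_top,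
    finrank_euclideanSpace_fin, finrank_euclideanSpace_fin, ← h.tangentTo_eq hp] at this
  omega

end IsCutOutBy

theorem isSmoothSubmanifold_of_isCutOutBy {c : ℕ} {S : Set E3}
    (h : ∀ p ∈ S, ∃ (U : Set E3) (u : Fin c → R3), IsCutOutBy S p U u) :
    IsSmoothSubmanifold c S := by
  intro p hp
  obtain ⟨U, u, hu⟩ := h p hp
  exact ⟨U, polyTuple u, hu.isOpen, hu.mem, (contDiff_polyTuple u).contDiffOn,
    surjective_fderiv_polyTuple hu.linearIndependent, hu.inter_eq⟩

/-! ### Restricting a corank one map to a subspace -/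

section CorankOne

variable {L : E3 →L[ℝ] E3} {T : Submodule ℝ E3} {k : E3}

theorem finrank_map_add_one_of_mem
    (h : Module.finrank ℝ (LinearMap.range (L : E3 →ₗ[ℝ] E3)) = 2) (hk : k ≠ 0) (hLk : L k = 0)
    (hkT : k ∈ T) : Module.finrank ℝ (T.map (L : E3 →ₗ[ℝ] E3)) + 1 = Module.finrank ℝ T := by
  rw [← LinearMap.finrank_range_add_finrank_ker ((L : E3 →ₗ[ℝ] E3).domRestrict T),
    LinearMap.range_domRestrict]
  congr 1
  symm
  refine (finrank_eq_one_iff_of_nonzero'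
    (⟨⟨k, hkT⟩, hLk⟩ : LinearMap.ker ((L : E3 →ₗ[ℝ] E3).domRestrict T)) ?_).mpr ?_
  · simpa [Subtype.ext_iff] using hk
  · rintro ⟨⟨v, hv⟩, hLv⟩
    exact ⟨inner ℝ k v / inner ℝ k k,
      Subtype.ext (Subtype.ext (eq_smul_of_corank_one h hk hLk hLv).symm)⟩

theorem finrank_map_of_notMem
    (h : Module.finrank ℝ (LinearMap.range (L : E3 →ₗ[ℝ] E3)) = 2) (hk : k ≠ 0) (hLk : L k = 0)
    (hkT : k ∉ T) : Module.finrank ℝ (T.map (L : E3 →ₗ[ℝ] E3)) = Module.finrank ℝ T := by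
  rw [← LinearMap.range_domRestrict]
  refine LinearMap.finrank_range_of_inj (LinearMap.ker_eq_bot.mp (LinearMap.ker_eq_bot'.mpr ?_))
  rintro ⟨v, hv⟩ hLv
  have hv' : v = (inner ℝ k v / inner ℝ k k : ℝ) • k := eq_smul_of_corank_one h hk hLk hLv
  by_contra hne
  refine hkT ?_
  generalize (inner ℝ k v / inner ℝ k k : ℝ) = t at hv'
  have ht : t ≠ 0 := by
    intro h0
    rw [h0, zero_smul] at hv'
    exact hne (Subtype.ext hv')
  rw [hv'] at hv
  exact (Submodule.smul_mem_iff T ht).mp hv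

end CorankOne

/-! ### The strata of a polynomial map -/

theorem exists_ne_zero_of_span_eq_top {s : Set R3} (h : Ideal.span s = ⊤) (p : E3) :
    ∃ u ∈ s, polyFun u p ≠ 0 := by
  by_contra! hs
  have hle : Ideal.span s ≤ RingHom.ker (eval fun j => p j) := Ideal.span_le.mpr hs
  rw [h] at hle
  have h1 : (1 : R3) ∈ RingHom.ker (eval fun j => p j) := hle trivial
  rw [RingHom.mem_ker, map_one] at h1
  exact one_ne_zero h1

theorem mem_realZeros_span {s : Set R3} {p : E3} :
    p ∈ realZeros (Ideal.span s) ↔ ∀ u ∈ s, polyFun u p = 0 := by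
  constructor
  · exact fun h u hu => h u (Ideal.subset_span hu)
  · intro h u hu
    exact (Ideal.span_le (I := RingHom.ker (eval fun j => p j))).mpr h hu

variable (f : Fin 3 → R3)

theorem fieldX_polyMap (i j : Fin 3) :
    fieldX (polyMap f) (polyMap (polyK f i j)) = polyFun (polyX f i j) := by
  rw [fieldX, jacobian_polyMap, along_polyFun, polyX]

theorem fieldY_polyMap (i j : Fin 3) :
    fieldY (polyMap f) (polyMap (polyK f i j)) = polyFun (polyY f i j) := by
  rw [fieldY, fieldX_polyMap, along_polyFun, polyY]

theorem fieldZ_polyMap (i j : Fin 3) :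
    fieldZ (polyMap f) (polyMap (polyK f i j)) = polyFun (polyZ f i j) := by
  rw [fieldZ, fieldY_polyMap, along_polyFun, polyZ]

theorem contDiff_jacobian_polyMap : ContDiff ℝ ∞ (jacobian (polyMap f)) := by
  rw [jacobian_polyMap]
  exact contDiff_polyFun _

theorem polyFun_polyG (i j : Fin 3) (p : E3) : polyFun (polyG f i j) p =
    fieldZ (polyMap f) (polyMap (polyK f i j)) p *
      (fderiv ℝ (fieldH (polyMap f) (polyMap (polyK f i j))) p).det := by
  rw [det_fderiv_fieldH (contDiff_jacobian_polyMap f) ((contDiff_polyMap _).smoothNear p), polyG,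
    polyFun_mul, fieldZ_polyMap, polyFun_det, gradMatrix, fieldX_polyMap, fieldY_polyMap,
    jacobian_polyMap, gradient_polyFun, gradient_polyFun, gradient_polyFun]
  congr 2
  ext a b
  fin_cases a <;> rfl

/-- The triple product is the determinant with rows `∇f_l, ∇f_i, ∇f_j`: it is `0` if an index
repeats and `±J` otherwise. Hence `K_{ij}` lies in the kernel of `Df` wherever `J = 0`. -/
theorem exists_dotProduct_polyK (i j l : Fin 3) :
    ∃ s : R3, grad (f l) ⬝ᵥ polyK f i j = s * polyJ f := by
  have hJ : polyJ f = (Matrix.of fun i => grad (f i)).det := rfl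
  simp only [hJ, Matrix.det_fin_three, Matrix.of_apply, polyK, cross_apply, dotProduct,
    Fin.sum_univ_three, Matrix.cons_val_zero, Matrix.cons_val_one, Matrix.cons_val]
  fin_cases i <;> fin_cases j <;> fin_cases l <;>
    first
    | exact ⟨0, by simp only [Fin.zero_eta, Fin.mk_one, Fin.reduceFinMk]; ring1⟩
    | exact ⟨1, by simp only [Fin.zero_eta, Fin.mk_one, Fin.reduceFinMk]; ring1⟩
    | exact ⟨-1, by simp only [Fin.zero_eta, Fin.mk_one, Fin.reduceFinMk]; ring1⟩

variable {f}

theorem fderiv_polyMap_polyK {p : E3} (hp : polyFun (polyJ f) p = 0) (i j : Fin 3) :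
    fderiv ℝ (polyMap f) p (polyMap (polyK f i j) p) = 0 := by
  ext l
  rw [fderiv_polyMap_apply, inner_polyMap]
  obtain ⟨s, hs⟩ := exists_dotProduct_polyK f i j l
  rw [hs, polyFun_mul, hp, mul_zero]
  rfl

/-- A vector killed by `∇f_i` and `∇f_j` is a multiple of `K_{ij}`. -/
theorem exists_smul_polyK_of_fderiv_eq_zero {p v : E3} {i j : Fin 3}
    (hK : polyMap (polyK f i j) p ≠ 0) (hv : fderiv ℝ (polyMap f) p v = 0) :
    ∃ c : ℝ, c • polyMap (polyK f i j) p = v := by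
  set k := polyMap (polyK f i j) p
  have hi : inner ℝ (polyMap (grad (f i)) p) v = (0 : ℝ) := by
    rw [← fderiv_polyMap_apply, hv]
    rfl
  have hj : inner ℝ (polyMap (grad (f j)) p) v = (0 : ℝ) := by
    rw [← fderiv_polyMap_apply, hv]
    rfl
  have hkk : inner ℝ k k ≠ (0 : ℝ) := by simpa using hK
  have k0 : k 0 = polyMap (grad (f i)) p 1 * polyMap (grad (f j)) p 2 -
      polyMap (grad (f i)) p 2 * polyMap (grad (f j)) p 1 := by
    simp [k, polyMap_apply, polyK, cross_apply, polyFun]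
  have k1 : k 1 = polyMap (grad (f i)) p 2 * polyMap (grad (f j)) p 0 -
      polyMap (grad (f i)) p 0 * polyMap (grad (f j)) p 2 := by
    simp [k, polyMap_apply, polyK, cross_apply, polyFun]
  have k2 : k 2 = polyMap (grad (f i)) p 0 * polyMap (grad (f j)) p 1 -
      polyMap (grad (f i)) p 1 * polyMap (grad (f j)) p 0 := by
    simp [k, polyMap_apply, polyK, cross_apply, polyFun]
  refine ⟨inner ℝ k v / inner ℝ k k, ?_⟩
  have key : inner ℝ k v • k = inner ℝ k k • v := by
    simp only [PiLp.inner_apply, Fin.sum_univ_three, RCLike.inner_apply, conj_trivial] at hi hj ⊢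
    generalize polyMap (grad (f i)) p = a at *
    generalize polyMap (grad (f j)) p = b at *
    -- `c0`, `c1`, `c2` say `k × v = 0`, from `(a × b) × v = ⟨a, v⟩ b - ⟨b, v⟩ a`. Expanding `k × (k
    -- × v) = 0` then gives the claim.
    have c0 : k 1 * v 2 - k 2 * v 1 = 0 := by
      rw [k1, k2]
      linear_combination b 0 * hi - a 0 * hj
    have c1 : k 2 * v 0 - k 0 * v 2 = 0 := by
      rw [k2, k0]
      linear_combination b 1 * hi - a 1 * hj
    have c2 : k 0 * v 1 - k 1 * v 0 = 0 := by
      rw [k0, k1]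
      linear_combination b 2 * hi - a 2 * hj
    ext l
    simp only [PiLp.smul_apply, smul_eq_mul]
    fin_cases l
    · simp only [Fin.zero_eta]
      linear_combination k 1 * c2 - k 2 * c1
    · simp only [Fin.mk_one]
      linear_combination k 2 * c0 - k 0 * c2
    · simp only [Fin.reduceFinMk]
      linear_combination k 0 * c1 - k 1 * c0
  rw [div_eq_inv_mul, ← smul_smul, key, smul_smul, inv_mul_cancel₀ hkk, one_smul]

/-- The components of the `K_{ij}` are, up to sign, the `2 × 2` minors of `Df`, and these have no
common zero with `J`. -/
theorem exists_polyK_ne_zero (h2 : ideal2 f = ⊤) {p : E3} (hp : polyFun (polyJ f) p = 0) :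
    ∃ i j : Fin 3, i < j ∧ polyMap (polyK f i j) p ≠ 0 := by
  by_contra! hK
  obtain ⟨u, hu, hne⟩ := exists_ne_zero_of_span_eq_top h2 p
  rcases hu with rfl | ⟨r, c, rfl⟩
  · exact hne hp
  · have h := hK (r 0) (r 1) (r.strictMono (by decide))
    have hc := c.strictMono (show (0 : Fin 2) < 1 by decide)
    have k0 : polyMap (polyK f (r 0) (r 1)) p 0 = 0 := by rw [h]; rfl
    have k1 : polyMap (polyK f (r 0) (r 1)) p 1 = 0 := by rw [h]; rfl
    have k2 : polyMap (polyK f (r 0) (r 1)) p 2 = 0 := by rw [h]; rfl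
    simp only [polyMap_apply, polyK, cross_apply, polyFun, Matrix.cons_val_zero,
      Matrix.cons_val_one, Matrix.cons_val, map_sub, map_mul] at k0 k1 k2
    apply hne
    simp only [polyFun, Matrix.det_fin_two, Matrix.submatrix_apply, derivMatrix, Matrix.of_apply,
      map_sub, map_mul]
    generalize c 0 = a at *
    generalize c 1 = b at *
    fin_cases a <;> fin_cases b <;> simp at hc <;>
      simp only [Fin.zero_eta, Fin.mk_one, Fin.reduceFinMk] <;> linarith

theorem mem_S1_iff (h2 : ideal2 f = ⊤) (p : E3) :
    p ∈ S1 (polyMap f) ↔ polyFun (polyJ f) p = 0 := by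
  have hdet : polyFun (polyJ f) p =
      LinearMap.det (fderiv ℝ (polyMap f) p : E3 →ₗ[ℝ] E3) := by
    rw [← jacobian_polyMap]
    rfl
  have hsum := LinearMap.finrank_range_add_finrank_ker (fderiv ℝ (polyMap f) p : E3 →ₗ[ℝ] E3)
  rw [finrank_euclideanSpace_fin] at hsum
  rw [S1, Set.mem_ofPred_eq]
  constructor
  · intro h
    by_contra hne
    rw [hdet] at hne
    have := LinearMap.range_eq_top.mpr (LinearMap.equivOfDetNeZero _ hne).surjective
    have h3 : LinearMap.range (fderiv ℝ (polyMap f) p : E3 →ₗ[ℝ] E3) = ⊤ := this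
    rw [h3, finrank_top, finrank_euclideanSpace_fin] at h
    omega
  · intro h
    obtain ⟨i, j, -, hK⟩ := exists_polyK_ne_zero h2 h
    have h1 : Module.finrank ℝ (LinearMap.ker (fderiv ℝ (polyMap f) p : E3 →ₗ[ℝ] E3)) = 1 := by
      refine (finrank_eq_one_iff_of_nonzero' (⟨polyMap (polyK f i j) p, fderiv_polyMap_polyK h i j⟩ :
        LinearMap.ker (fderiv ℝ (polyMap f) p : E3 →ₗ[ℝ] E3)) ?_).mpr ?_
      · simpa [Subtype.ext_iff] using hK
      · rintro ⟨v, hv⟩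
        obtain ⟨c, hc⟩ := exists_smul_polyK_of_fderiv_eq_zero hK hv
        exact ⟨c, Subtype.ext hc⟩
    omega

theorem mem_S1_iff_jacobian (h2 : ideal2 f = ⊤) (p : E3) :
    p ∈ S1 (polyMap f) ↔ jacobian (polyMap f) p = 0 := by
  rw [mem_S1_iff h2, jacobian_polyMap]

theorem isWeakKernelField_polyK (h2 : ideal2 f = ⊤) (i j : Fin 3) (p : E3) :
    IsWeakKernelField (polyMap f) p (polyMap (polyK f i j)) :=
  Filter.Eventually.of_forall fun q =>
    ⟨(contDiff_polyMap _).contDiffAt, fun hq => fderiv_polyMap_polyK ((mem_S1_iff h2 q).mp hq) i j⟩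

theorem grad_polyJ_ne_zero (h1 : ideal1 f = ⊤) {p : E3} (hp : polyFun (polyJ f) p = 0) :
    polyMap (grad (polyJ f)) p ≠ 0 := by
  intro h
  obtain ⟨u, hu, hne⟩ := exists_ne_zero_of_span_eq_top h1 p
  rcases hu with rfl | ⟨i, rfl⟩
  · exact hne hp
  · apply hne
    rw [← polyMap_apply, h]
    rfl

theorem isCutOutBy_S1 (h1 : ideal1 f = ⊤) (h2 : ideal2 f = ⊤) {p : E3}
    (hp : p ∈ S1 (polyMap f)) : IsCutOutBy (S1 (polyMap f)) p Set.univ ![polyJ f] where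
  isOpen := isOpen_univ
  mem := trivial
  mem_iff q _ := by simp [mem_S1_iff h2]
  linearIndependent := by
    rw [linearIndependent_unique_iff]
    exact grad_polyJ_ne_zero h1 ((mem_S1_iff h2 p).mp hp)

/-- The tangent plane of the surface is `∇J^⊥` and `K_{ij}` spans the kernel of `Df`, so the rank on
that plane drops from 2 to 1 exactly when `⟨∇J, K_{ij}⟩ = 0`. -/
theorem mem_S11_iff (h1 : ideal1 f = ⊤) (h2 : ideal2 f = ⊤) {p : E3} {i j : Fin 3}
    (hK : polyMap (polyK f i j) p ≠ 0) : p ∈ S11 (polyMap f) ↔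
      polyFun (polyJ f) p = 0 ∧ polyFun (polyX f i j) p = 0 := by
  rw [S11, Set.mem_ofPred_eq, ← mem_S1_iff h2]
  refine and_congr_right fun hp => ?_
  have hcut := isCutOutBy_S1 h1 h2 hp
  have hdim := hcut.finrank_tangentTo hp
  have hmem : polyMap (polyK f i j) p ∈ tangentTo (S1 (polyMap f)) p ↔
      polyFun (polyX f i j) p = 0 := by
    rw [hcut.mem_tangentTo hp, polyX, ← inner_polyMap]
    simp
  have hker := fderiv_polyMap_polyK ((mem_S1_iff h2 p).mp hp) i j
  rw [← hmem, rankRestrict]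
  constructor
  · intro h
    by_contra hn
    have := finrank_map_of_notMem hp hK hker hn
    omega
  · intro h
    have := finrank_map_add_one_of_mem hp hK hker h
    omega

/-- The comparison of `K_{ij}` with `K_{kl}` at a point of `S11` where `K_{ij}` does not vanish. -/
theorem comparison_polyK (h1 : ideal1 f = ⊤) (h2 : ideal2 f = ⊤) {p : E3} {i j : Fin 3}
    (hK : polyMap (polyK f i j) p ≠ 0) (hp : p ∈ S11 (polyMap f)) (k l : Fin 3) :
    ∃ c : ℝ, polyFun (polyX f k l) p = 0 ∧
      (∃ a : ℝ, polyMap (grad (polyX f k l)) p =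
        c • polyMap (grad (polyX f i j)) p + a • polyMap (grad (polyJ f)) p) ∧
      polyFun (polyY f k l) p = c ^ 2 * polyFun (polyY f i j) p ∧
      (polyFun (polyY f i j) p = 0 →
        polyFun (polyG f k l) p = c ^ 6 * polyFun (polyG f i j) p) := by
  obtain ⟨hJ, hX⟩ := (mem_S11_iff h1 h2 hK).mp hp
  have hk : IsKernelField (polyMap f) p (polyMap (polyK f i j)) :=
    ⟨hK, isWeakKernelField_polyK h2 i j p⟩
  obtain ⟨c, -, r1, r2, r3, r4⟩ := hk.comparison (contDiff_jacobian_polyMap f)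
    (mem_S1_iff_jacobian h2) (isWeakKernelField_polyK h2 k l p) hp.1
    (by rw [jacobian_polyMap, gradient_polyFun]; exact grad_polyJ_ne_zero h1 hJ)
    (by rw [fieldX_polyMap, hX])
  rw [← polyFun_polyG, ← polyFun_polyG] at r4
  simp only [fieldX_polyMap, fieldY_polyMap, jacobian_polyMap, gradient_polyFun] at r1 r2 r3 r4
  exact ⟨c, r1, r2, r3, r4⟩

theorem isCutOutBy_S11 (h1 : ideal1 f = ⊤) (h2 : ideal2 f = ⊤) (h3 : ideal3 f = ⊤) {p : E3}
    {i j : Fin 3} (hK : polyMap (polyK f i j) p ≠ 0) (hp : p ∈ S11 (polyMap f)) :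
    IsCutOutBy (S11 (polyMap f)) p {q | polyMap (polyK f i j) q ≠ 0}
      ![polyJ f, polyX f i j] where
  isOpen := isOpen_ne_fun (contDiff_polyMap (n := 0) _).continuous continuous_const
  mem := hK
  mem_iff q hq := by simp [mem_S11_iff h1 h2 hq, Fin.forall_fin_two]
  linearIndependent := by
    obtain ⟨hJ, hX⟩ := (mem_S11_iff h1 h2 hK).mp hp
    have hne := grad_polyJ_ne_zero h1 hJ
    have hfun : (fun n => polyMap (grad ((![polyJ f, polyX f i j] : Fin 2 → R3) n)) p) =
        ![polyMap (grad (polyJ f)) p, polyMap (grad (polyX f i j)) p] := by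
      ext1 n
      fin_cases n <;> rfl
    rw [hfun, LinearIndependent.pair_iff' hne]
    intro a ha
    -- If `∇X_{ij}` were a multiple of `∇J` at `p`, then by comparison so would be all `∇X_{kl}`.
    -- All generators of `I₃` would then vanish at `p`, against `I₃ = (1)`.
    have hpar : ∀ k l, ∃ s : ℝ,
        polyMap (grad (polyX f k l)) p = s • polyMap (grad (polyJ f)) p := by
      intro k l
      obtain ⟨c, -, ⟨b, hb⟩, -⟩ := comparison_polyK h1 h2 hK hp k l
      exact ⟨c * a + b, by rw [hb, ← ha, add_smul, smul_smul]⟩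
    have hX0 : ∀ k l, polyFun (polyX f k l) p = 0 := by
      intro k l
      obtain ⟨c, h, -⟩ := comparison_polyK h1 h2 hK hp k l
      exact h
    have hrow : ∀ r : Fin 4, ∃ s : ℝ, polyMap (grad ((![polyJ f, polyX f 0 1, polyX f 0 2,
        polyX f 1 2] : Fin 4 → R3) r)) p = s • polyMap (grad (polyJ f)) p := by
      intro r
      fin_cases r
      · exact ⟨1, (one_smul _ _).symm⟩
      · exact hpar 0 1
      · exact hpar 0 2
      · exact hpar 1 2
    obtain ⟨u, hu, hu0⟩ := exists_ne_zero_of_span_eq_top h3 p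
    rcases hu with (rfl | rfl | rfl | rfl) | ⟨r, c, rfl⟩
    · exact hu0 hJ
    · exact hu0 (hX0 _ _)
    · exact hu0 (hX0 _ _)
    · exact hu0 (hX0 _ _)
    · apply hu0
      obtain ⟨s, hs⟩ := hrow (r 0)
      obtain ⟨t, ht⟩ := hrow (r 1)
      have hs' : ∀ d, polyFun (derivMatrix ![polyJ f, polyX f 0 1, polyX f 0 2, polyX f 1 2]
          (r 0) d) p = s * polyMap (grad (polyJ f)) p d := fun d => congrArg (fun w : E3 => w d) hs
      have ht' : ∀ d, polyFun (derivMatrix ![polyJ f, polyX f 0 1, polyX f 0 2, polyX f 1 2]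
          (r 1) d) p = t * polyMap (grad (polyJ f)) p d := fun d => congrArg (fun w : E3 => w d) ht
      rw [Matrix.det_fin_two]
      simp only [Matrix.submatrix_apply]
      have hsub : ∀ a b : R3, polyFun (a - b) p = polyFun a p - polyFun b p := by
        intro a b
        simp [polyFun]
      rw [hsub, polyFun_mul, polyFun_mul, hs', hs', ht', ht']
      ring

/-- The tangent line of the curve is the orthogonal complement of `∇J` and `∇X_{ij}`; as `X_{ij} =
0` already, `K_{ij}` spans it exactly when `Y_{ij} = 0`. -/
theorem mem_S111_iff (h1 : ideal1 f = ⊤) (h2 : ideal2 f = ⊤) (h3 : ideal3 f = ⊤) {p : E3}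
    {i j : Fin 3} (hK : polyMap (polyK f i j) p ≠ 0) : p ∈ S111 (polyMap f) ↔
      p ∈ S11 (polyMap f) ∧ polyFun (polyY f i j) p = 0 := by
  rw [S111, Set.mem_ofPred_eq]
  refine and_congr_right fun hp => ?_
  have hcut := isCutOutBy_S11 h1 h2 h3 hK hp
  have hdim := hcut.finrank_tangentTo hp
  obtain ⟨hJ, hX⟩ := (mem_S11_iff h1 h2 hK).mp hp
  have hmem : polyMap (polyK f i j) p ∈ tangentTo (S11 (polyMap f)) p ↔
      polyFun (polyY f i j) p = 0 := by
    have hX' : inner ℝ (polyMap (grad (polyJ f)) p) (polyMap (polyK f i j) p) = (0 : ℝ) := by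
      rw [inner_polyMap]
      exact hX
    rw [hcut.mem_tangentTo hp, polyY, ← inner_polyMap, Fin.forall_fin_two]
    simp [hX']
  have hker := fderiv_polyMap_polyK hJ i j
  rw [← hmem, rankRestrict]
  constructor
  · intro h
    by_contra hn
    have := finrank_map_of_notMem hp.1 hK hker hn
    omega
  · intro h
    have := finrank_map_add_one_of_mem hp.1 hK hker h
    omega

/-- Membership is tested with one nonvanishing `K_{ij}`; `comparison_polyK` carries the vanishing of
`X` and `Y` over to all other index pairs. -/
theorem S111_eq_realZeros (h1 : ideal1 f = ⊤) (h2 : ideal2 f = ⊤) (h3 : ideal3 f = ⊤) :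
    S111 (polyMap f) = realZeros (idealI f) := by
  ext p
  rw [idealI, mem_realZeros_span]
  constructor
  · intro hp
    have hJ := (mem_S1_iff h2 p).mp hp.1.1
    obtain ⟨i, j, -, hK⟩ := exists_polyK_ne_zero h2 hJ
    obtain ⟨hp', hY⟩ := (mem_S111_iff h1 h2 h3 hK).mp hp
    rintro u (rfl | ⟨k, l, -, hu⟩)
    · exact hJ
    · obtain ⟨c, hX, -, hY', -⟩ := comparison_polyK h1 h2 hK hp' k l
      rcases hu with rfl | rfl
      · exact hX
      · rw [hY', hY, mul_zero]
  · intro h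
    have hJ := h (polyJ f) (Or.inl rfl)
    obtain ⟨i, j, hij, hK⟩ := exists_polyK_ne_zero h2 hJ
    exact (mem_S111_iff h1 h2 h3 hK).mpr
      ⟨(mem_S11_iff h1 h2 hK).mpr ⟨hJ, h _ (Or.inr ⟨i, j, hij, Or.inl rfl⟩)⟩,
        h _ (Or.inr ⟨i, j, hij, Or.inr rfl⟩)⟩

/-- If `g` does not vanish at a point of `S111`, this is a simple swallowtail point, whose sign is
the sign of `g`. -/
theorem swallowtailSign_eq_sign_weightedG (h1 : ideal1 f = ⊤) (h2 : ideal2 f = ⊤)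
    (h3 : ideal3 f = ⊤) {α : Fin 3 → Fin 3 → ℝ} (hα : ∀ i j, i < j → 0 ≤ α i j) {p : E3}
    (hp : p ∈ S111 (polyMap f)) (hg : polyFun (weightedG f α) p ≠ 0) :
    IsSimpleSwallowtail (polyMap f) p ∧
      swallowtailSign (polyMap f) p = SignType.sign (polyFun (weightedG f α) p) := by
  have hJ := (mem_S1_iff h2 p).mp hp.1.1
  obtain ⟨i, j, -, hK⟩ := exists_polyK_ne_zero h2 hJ
  obtain ⟨hp', hY⟩ := (mem_S111_iff h1 h2 h3 hK).mp hp
  obtain ⟨-, hX⟩ := (mem_S11_iff h1 h2 hK).mp hp'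
  choose c _ _ _ hc using comparison_polyK h1 h2 hK hp'
  -- Every `g_{kl}(p)` is `c⁶ g_{ij}(p)`, so `g(p)` is a nonnegative multiple of `g_{ij}(p)`; since
  -- `g(p) ≠ 0`, the multiple is positive.
  have hsum : polyFun (weightedG f α) p =
      (∑ k, ∑ l ∈ Finset.Ioi k, α k l * c k l ^ 6) * polyFun (polyG f i j) p := by
    simp only [Finset.sum_mul]
    simp only [mul_assoc, ← hc _ _ hY]
    simp [weightedG, polyFun]
  have hnn : 0 ≤ ∑ k, ∑ l ∈ Finset.Ioi k, α k l * c k l ^ 6 :=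
    Finset.sum_nonneg fun k _ => Finset.sum_nonneg fun l hl =>
      mul_nonneg (hα k l (Finset.mem_Ioi.mp hl)) (by positivity)
  rw [hsum] at hg ⊢
  have hpos := lt_of_le_of_ne hnn (left_ne_zero_of_mul hg).symm
  rw [sign_mul, sign_pos hpos, one_mul, polyFun_polyG]
  have hG := right_ne_zero_of_mul hg
  rw [polyFun_polyG] at hG
  refine IsKernelField.swallowtailSign_eq (contDiff_jacobian_polyMap f) (mem_S1_iff_jacobian h2)
    ⟨hK, isWeakKernelField_polyK h2 i j p⟩ hp.1.1 ?_ ?_ ?_ hG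
  · rw [jacobian_polyMap, gradient_polyFun]
    exact grad_polyJ_ne_zero h1 hJ
  · rw [fieldX_polyMap, hX]
  · rw [fieldY_polyMap, hY]

/-! ### Real zeros and real characters -/

/-- Evaluation at a real zero of an ideal. -/
def evalAt {I : Ideal R3} (p : realZeros I) : (R3 ⧸ I) →ₐ[ℝ] ℝ :=
  Ideal.Quotient.liftₐ I (aeval fun j => p.1 j) fun u hu => by
    rw [aeval_eq_eval]
    exact p.2 u hu

theorem evalAt_mk {I : Ideal R3} (p : realZeros I) (u : R3) :
    evalAt p (Ideal.Quotient.mk I u) = polyFun u p := by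
  change aeval (fun j => p.1 j) u = _
  rw [aeval_eq_eval]
  rfl

/-- A character is determined by the images of the variables, and these are the coordinates of a
real zero of `I`. -/
theorem evalAt_bijective (I : Ideal R3) : Function.Bijective (evalAt (I := I)) := by
  constructor
  · intro p q h
    ext i
    have := congrArg (fun φ => φ (Ideal.Quotient.mk I (X i))) h
    simpa [evalAt_mk, polyFun] using this
  · intro φ
    have hφ : ∀ u, polyFun u (WithLp.toLp 2 fun i => φ (Ideal.Quotient.mk I (X i))) =
        φ (Ideal.Quotient.mk I u) := by
      intro u
      have : (aeval fun i => φ (Ideal.Quotient.mk I (X i))) =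
          φ.comp (Ideal.Quotient.mkₐ ℝ I) := by
        ext i
        simp
      have h := DFunLike.congr_fun this u
      rw [aeval_eq_eval] at h
      exact h
    refine ⟨⟨WithLp.toLp 2 fun i => φ (Ideal.Quotient.mk I (X i)), fun u hu => ?_⟩, ?_⟩
    · exact (hφ u).trans (by rw [Ideal.Quotient.eq_zero_iff_mem.mpr hu, map_zero])
    · refine AlgHom.ext fun a => ?_
      obtain ⟨u, rfl⟩ := Ideal.Quotient.mk_surjective a
      rw [evalAt_mk, hφ]

theorem finite_realZeros (I : Ideal R3) [Module.Finite ℝ (R3 ⧸ I)] : (realZeros I).Finite := by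
  have := finite_algHom (R3 ⧸ I)
  have : Finite (realZeros I) := Finite.of_injective _ (evalAt_bijective I).injective
  exact Set.toFinite _

theorem signature_traceQuad_mk (I : Ideal R3) [Module.Finite ℝ (R3 ⧸ I)] (u : R3) :
    signature (traceQuad (Ideal.Quotient.mk I u)) =
      ∑ᶠ p ∈ realZeros I, (SignType.sign (polyFun u p) : ℤ) := by
  rw [signature_traceQuad, ← finsum_set_coe_eq_finsum_mem]
  exact (finsum_eq_of_bijective _ (evalAt_bijective I) fun p => by rw [evalAt_mk]).symm

/-! ### Counting signs -/

theorem ncard_eq_one_add_ncard_eq_neg_one {β : Type*} {S : Set β} (hS : S.Finite) (s : β → ℤ)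
    (hs : ∀ p ∈ S, s p = 1 ∨ s p = -1) :
    {p ∈ S | s p = 1}.ncard + {p ∈ S | s p = -1}.ncard = S.ncard ∧
      ({p ∈ S | s p = 1}.ncard : ℤ) - {p ∈ S | s p = -1}.ncard = ∑ᶠ p ∈ S, s p := by
  classical
  obtain ⟨T, rfl⟩ := hS.exists_finset_coe
  have h1 : ∀ e : ℤ, {p ∈ (T : Set β) | s p = e}.ncard = (T.filter fun p => s p = e).card := by
    intro e
    rw [← Set.ncard_coe_finset, Finset.coe_filter]
    rfl
  rw [h1, h1, Set.ncard_coe_finset, finsum_mem_coe_finset, Finset.card_filter, Finset.card_filter,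
    ← Finset.sum_add_distrib, Finset.card_eq_sum_ones]
  push_cast
  rw [← Finset.sum_sub_distrib]
  constructor <;> refine Finset.sum_congr rfl fun p hp => ?_ <;>
    rcases hs p hp with h | h <;> simp [h]

end Swallowtail

end

open Swallowtail
theorem theorem8p5 (f : Fin 3 → R3)
    (h1 : ideal1 f = ⊤) (h2 : ideal2 f = ⊤) (h3 : ideal3 f = ⊤)
    (hA : Module.Finite ℝ (AlgA f)) :
    -- the sets in the definition of `S111` are submanifolds, as that definition presupposes
    IsSmoothSubmanifold 1 (S1 (polyMap f)) ∧
    IsSmoothSubmanifold 2 (S11 (polyMap f)) ∧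
    S111 (polyMap f) = realZeros (idealI f) ∧
    (S111 (polyMap f)).Finite ∧
    signature (formTheta f) = ((S111 (polyMap f)).ncard : ℤ) ∧
    ∀ α : Fin 3 → Fin 3 → ℝ,
      (∀ i j, i < j → 0 ≤ α i j) → (∃ i j, i < j ∧ 0 < α i j) →
      (QuadraticMap.associated (formPsi f α)).Nondegenerate →
        (∀ p ∈ S111 (polyMap f), IsSimpleSwallowtail (polyMap f) p) ∧
        signature (formPsi f α)
          = ∑ᶠ p ∈ S111 (polyMap f), swallowtailSign (polyMap f) p ∧
        (({p ∈ S111 (polyMap f) | swallowtailSign (polyMap f) p = 1}.ncard : ℕ) : ℚ)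
          = ((signature (formTheta f) : ℚ) + (signature (formPsi f α) : ℚ)) / 2 ∧
        (({p ∈ S111 (polyMap f) | swallowtailSign (polyMap f) p = -1}.ncard : ℕ) : ℚ)
          = ((signature (formTheta f) : ℚ) - (signature (formPsi f α) : ℚ)) / 2 := by
  have hS := S111_eq_realZeros h1 h2 h3
  have hfin : (S111 (polyMap f)).Finite := hS ▸ finite_realZeros (idealI f)
  have hΘ : signature (formTheta f) = ((S111 (polyMap f)).ncard : ℤ) := by
    rw [formTheta, ← map_one (Ideal.Quotient.mk (idealI f)), signature_traceQuad_mk, ← hS,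
      finsum_mem_eq_finite_toFinset_sum _ hfin, Set.ncard_eq_toFinset_card _ hfin]
    simp [polyFun]
  refine ⟨isSmoothSubmanifold_of_isCutOutBy fun p hp => ⟨_, _, isCutOutBy_S1 h1 h2 hp⟩,
    isSmoothSubmanifold_of_isCutOutBy fun p hp => ?_, hS, hfin, hΘ, ?_⟩
  · obtain ⟨i, j, -, hK⟩ := exists_polyK_ne_zero h2 ((mem_S1_iff h2 p).mp hp.1)
    exact ⟨_, _, isCutOutBy_S11 h1 h2 h3 hK hp⟩
  intro α hα _ hnd
  -- Evaluation at `p` is a real character of `𝒜`, and non-degeneracy of `Ψ` keeps `g` from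
  -- vanishing under any such character.
  have hg : ∀ p ∈ S111 (polyMap f), polyFun (weightedG f α) p ≠ 0 := by
    intro p hp
    rw [hS] at hp
    rw [← evalAt_mk (I := idealI f) ⟨p, hp⟩]
    exact algHom_ne_zero_of_nondegenerate _ _ hnd _
  have hsign := fun p hp => swallowtailSign_eq_sign_weightedG h1 h2 h3 hα hp (hg p hp)
  have hΨ : signature (formPsi f α) =
      ∑ᶠ p ∈ S111 (polyMap f), swallowtailSign (polyMap f) p := by
    rw [formPsi, signature_traceQuad_mk, ← hS]
    exact finsum_mem_congr rfl fun p hp => (hsign p hp).2.symm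
  obtain ⟨hadd, hsub⟩ := ncard_eq_one_add_ncard_eq_neg_one hfin (swallowtailSign (polyMap f))
    fun p hp => by
      rw [(hsign p hp).2]
      rcases (hg p hp).lt_or_gt with h | h
      · simp [sign_neg h]
      · simp [sign_pos h]
  refine ⟨fun p hp => (hsign p hp).1, hΨ, ?_, ?_⟩
  · rw [hΘ, hΨ, ← hsub, ← hadd]
    push_cast
    ring
  · rw [hΘ, hΨ, ← hsub, ← hadd]
    push_cast
    ring
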